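/- A (connected) map $\mathcal M$, possibly non-orientable or with boundary, is given by a non-empty set $\Phi$ of flags and permutations $r_0,r_1,r_2$ of $\Phi$ with $r_0^2=r_1^2=r_2^2=(r_0r_2)^2=1$, generating a transitive group on $\Phi$. Its edges are the orbits of $\langle r_0,r_2\rangle$; an isomorphism of maps is a bijection of flags commuting with $r_0,r_1,r_2$. The group ${\rm Aut}\,\mathcal M$ is the centraliser of $\langle r_0,r_1,r_2\rangle$ in ${\rm Sym}\,\Phi$; $\mathcal M$ is edge-transitive if ${\rm Aut}\,\mathcal M$ is transitive on edges. The quotient map $\mathcal M/{\rm Aut}\,\mathcal M$ has as flags the orbits of ${\rm Aut}\,\mathcal M$ on $\Phi$, with the induced permutations. The dual $D(\mathcal M)$ is obtained by replacing $(r_0,r_1,r_2)$ with $(r_2,r_1,r_0)$, and the Petrie dual $P(\mathcal M)$ by replacing it with $(r_0r_2,r_1,r_2)$. The 14 Graver–Watkins classes $T$ are $1$, $3$, and $2^\sigma$, $2^\sigma{\rm ex}$, $4^\sigma$, $5^\sigma$ with $\sigma\in\{\emptyset,*,P\}$; an edge-transitive map $\mathcal M$ is in $T$ when $\mathcal M/{\rm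 Aut}\,\mathcal M\cong\mathcal N(T)$, where the one-edge maps $\mathcal N(T)$ are as follows. - $\mathcal N(1)$ has one flag. - $\mathcal N(2)$ and $\mathcal N(2\,{\rm ex})$ have two flags. In both, $r_0$ transposes them and $r_2=1$; $r_1=1$ in $\mathcal N(2)$ and $r_1=r_0$ in $\mathcal N(2\,{\rm ex})$. - $\mathcal N(3)$, $\mathcal N(4)$ and $\mathcal N(5)$ have flag set $\{0,1\}^2$, with $r_0$ and $r_2$ changing the first and the second coordinate respectively; $r_1=1$ in $\mathcal N(3)$, $r_1$ is the transposition of $(1,0)$ and $(1,1)$ in $\mathcal N(4)$, and $r_1=r_2$ in $\mathcal N(5)$. - For $T=2,\,2\,{\rm ex},\,4,\,5$, the maps for the superscripts $*$ and $P$ are $D(\mathcal N(T))$ and $P(D(\mathcal N(T)))$ respectively. Let $\mathcal G(T)$ be the set of groups isomorphic to ${\rm Aut}\,\mathcal M$ for some map $\mathcal M\in T$. **Theorem 6.1.** Let $q$ be a prime power such that $L_2(q)=PSL_2(\mathbb F_q)$ is simple, and let $T$ be one of the 14 classes. Then $L_2(q)\in\mathcal G(T)$ if and only if either $T=1$ and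 $q\neq 7,9$, or $T\in\{2^\sigma,3,4^\sigma\}$ for some $\sigma\in\{\emptyset,*,P\}$. In particular, $L_2(q)\notin\mathcal G(2^\sigma{\rm ex})$ and $L_2(q)\notin\mathcal G(5^\sigma)$ for all $\sigma$. -/

import Mathlib

universe u

/-- A (not necessarily connected) map on a surface, possibly non-orientable or with non-empty
boundary, given by its set `Φ` of flags and a permutation representation on `Φ` of the group
`⟨R₀, R₁, R₂ ∣ Rᵢ² = (R₀R₂)² = 1⟩`.  The permutation `rᵢ` changes the `i`-dimensional component of
a flag; it may fix flags (this happens at free edges and on the boundary).  Vertices, edges and faces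
are the orbits of `⟨r₁, r₂⟩`, `⟨r₀, r₂⟩` and `⟨r₀, r₁⟩`. -/
structure FlagMap (Φ : Type u) where
  r₀ : Equiv.Perm Φ
  r₁ : Equiv.Perm Φ
  r₂ : Equiv.Perm Φ
  sq₀ : r₀ ^ 2 = 1
  sq₁ : r₁ ^ 2 = 1
  sq₂ : r₂ ^ 2 = 1
  sq₀₂ : (r₀ * r₂) ^ 2 = 1

namespace FlagMap

variable {Φ : Type u}

/-- The monodromy group `⟨r₀, r₁, r₂⟩`. -/
def mon (M : FlagMap Φ) : Subgroup (Equiv.Perm Φ) :=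
  Subgroup.closure {M.r₀, M.r₁, M.r₂}

/-- The automorphism group: the centraliser of the monodromy group in `Sym Φ`. -/
def aut (M : FlagMap Φ) : Subgroup (Equiv.Perm Φ) :=
  Subgroup.centralizer (M.mon : Set (Equiv.Perm Φ))

/-- The group `⟨r₀, r₂⟩`, whose orbits on flags are the edges. -/
def edgeGroup (M : FlagMap Φ) : Subgroup (Equiv.Perm Φ) :=
  Subgroup.closure {M.r₀, M.r₂}

/-- A map is connected if it has a flag and its monodromy group is transitive on flags. -/
def Connected (M : FlagMap Φ) : Prop :=
  Nonempty Φ ∧ ∀ x y : Φ, ∃ g ∈ M.mon, g x = y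

/-- The automorphism group is transitive on edges: for any two flags `x` and `y`, some automorphism
takes the edge of `x` to the edge of `y`. -/
def EdgeTransitive (M : FlagMap Φ) : Prop :=
  ∀ x y : Φ, ∃ a ∈ M.aut, ∃ g ∈ M.edgeGroup, g (a x) = y

/-- Isomorphism of maps: a bijection of the flags commuting with the `rᵢ`. -/
def Isomorphic {Ψ : Type*} (M : FlagMap Φ) (N : FlagMap Ψ) : Prop :=
  ∃ f : Φ ≃ Ψ, (∀ x, f (M.r₀ x) = N.r₀ (f x)) ∧ (∀ x, f (M.r₁ x) = N.r₁ (f x)) ∧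
    (∀ x, f (M.r₂ x) = N.r₂ (f x))

/-- The flags of the quotient map `M / Aut M`: the orbits of `Aut M` on the flags of `M`. -/
abbrev QuotientFlags (M : FlagMap Φ) : Type u :=
  MulAction.orbitRel.Quotient M.aut Φ

theorem orbitRel_apply_iff (M : FlagMap Φ) {g : Equiv.Perm Φ} (hg : g ∈ M.mon) (x y : Φ) :
    MulAction.orbitRel M.aut Φ x y ↔ MulAction.orbitRel M.aut Φ (g x) (g y) := by
  have key : ∀ (h : Equiv.Perm Φ), h ∈ M.mon → ∀ x y : Φ,
      MulAction.orbitRel M.aut Φ x y → MulAction.orbitRel M.aut Φ (h x) (h y) := by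
    rintro h hh x y ⟨a, rfl⟩
    refine ⟨a, ?_⟩
    have := Subgroup.mem_centralizer_iff.mp a.2 h hh
    exact (congrArg (fun p : Equiv.Perm Φ => p y) this).symm
  refine ⟨key g hg x y, fun h => ?_⟩
  simpa using key g⁻¹ (M.mon.inv_mem hg) _ _ h

/-- The permutation of `M / Aut M` induced by an element of the monodromy group. -/
def quotientPerm (M : FlagMap Φ) (g : Equiv.Perm Φ) (hg : g ∈ M.mon) :
    Equiv.Perm M.QuotientFlags :=
  Quotient.congr g (M.orbitRel_apply_iff hg)

/-- The quotient map `M / Aut M`. -/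
def quotient (M : FlagMap Φ) : FlagMap M.QuotientFlags where
  r₀ := M.quotientPerm M.r₀ (Subgroup.subset_closure (by simp))
  r₁ := M.quotientPerm M.r₁ (Subgroup.subset_closure (by simp))
  r₂ := M.quotientPerm M.r₂ (Subgroup.subset_closure (by simp))
  sq₀ := by
    ext x
    induction x using Quotient.inductionOn with
    | _ x => exact congrArg (Quotient.mk _) (congrArg (fun p : Equiv.Perm Φ => p x) M.sq₀)
  sq₁ := by
    ext x
    induction x using Quotient.inductionOn with
    | _ x => exact congrArg (Quotient.mk _) (congrArg (fun p : Equiv.Perm Φ => p x) M.sq₁)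
  sq₂ := by
    ext x
    induction x using Quotient.inductionOn with
    | _ x => exact congrArg (Quotient.mk _) (congrArg (fun p : Equiv.Perm Φ => p x) M.sq₂)
  sq₀₂ := by
    ext x
    induction x using Quotient.inductionOn with
    | _ x => exact congrArg (Quotient.mk _) (congrArg (fun p : Equiv.Perm Φ => p x) M.sq₀₂)

/-- The classical dual `D(M)`: `R₀` and `R₂` are transposed. -/
def dual (M : FlagMap Φ) : FlagMap Φ where
  r₀ := M.r₂
  r₁ := M.r₁
  r₂ := M.r₀
  sq₀ := M.sq₂
  sq₁ := M.sq₁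
  sq₂ := M.sq₀
  sq₀₂ := by
    have h := M.sq₀₂
    have h₀ := M.sq₀
    have h₂ := M.sq₂
    rw [sq] at h h₀ h₂ ⊢
    have e : M.r₂ * M.r₀ = (M.r₀ * M.r₂)⁻¹ := by
      rw [mul_inv_rev, inv_eq_of_mul_eq_one_left h₀, inv_eq_of_mul_eq_one_left h₂]
    rw [e, ← mul_inv_rev, h, inv_one]

/-- The Petrie dual `P(M)`: `R₀` and `R₀R₂` are transposed, while `R₁` and `R₂` are fixed. -/
def petrie (M : FlagMap Φ) : FlagMap Φ where
  r₀ := M.r₀ * M.r₂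
  r₁ := M.r₁
  r₂ := M.r₂
  sq₀ := M.sq₀₂
  sq₁ := M.sq₁
  sq₂ := M.sq₂
  sq₀₂ := by
    have h₂ := M.sq₂
    rw [sq] at h₂
    rw [mul_assoc, h₂, mul_one, M.sq₀]

end FlagMap

/-- The superscript `σ`: the empty symbol, `*` or `P`. -/
inductive ClassSuperscript
  | empty
  | star
  | P

/-- The 14 Graver–Watkins classes of edge-transitive maps:
`1`, `2^σ`, `2^σ ex`, `3`, `4^σ`, `5^σ`. -/
inductive EdgeTransitiveClass
  | one
  | two (σ : ClassSuperscript)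
  | twoEx (σ : ClassSuperscript)
  | three
  | four (σ : ClassSuperscript)
  | five (σ : ClassSuperscript)

/-- In each of the orbits `2^σ`, `2^σ ex`, `4^σ`, `5^σ`, the duality `D` takes the first class to the
class with superscript `*`, and `P` takes the latter to the class with superscript `P`. -/
def ClassSuperscript.op {Φ : Type} : ClassSuperscript → FlagMap Φ → FlagMap Φ
  | .empty, M => M
  | .star, M => M.dual
  | .P, M => M.dual.petrie

namespace EdgeTransitiveClass

/-- The flags of the one-edge map `𝒩(T)`. -/
abbrev BasicFlags : EdgeTransitiveClass → Type
  | one => Unit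
  | two _ => Bool
  | twoEx _ => Bool
  | three => Bool × Bool
  | four _ => Bool × Bool
  | five _ => Bool × Bool

/-- `(a, b) ↦ (¬a, b)`. -/
def flip₁ : Equiv.Perm (Bool × Bool) := Equiv.prodCongr Equiv.boolNot (Equiv.refl Bool)

/-- `(a, b) ↦ (a, ¬b)`. -/
def flip₂ : Equiv.Perm (Bool × Bool) := Equiv.prodCongr (Equiv.refl Bool) Equiv.boolNot

/-- `𝒩(2)`: an edge along the boundary of a closed disc, joining two boundary vertices.  Only `r₀`
moves flags, so a flag stabiliser is generated by `R₁`, `R₁^R₀`, `R₂`. -/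
def basicTwo : FlagMap Bool where
  r₀ := Equiv.boolNot
  r₁ := 1
  r₂ := 1
  sq₀ := by decide
  sq₁ := by decide
  sq₂ := by decide
  sq₀₂ := by decide

/-- `𝒩(2 ex)`: a loop along the whole boundary of a closed disc.  A flag stabiliser is generated by
`R₂` and `R₀R₁`. -/
def basicTwoEx : FlagMap Bool where
  r₀ := Equiv.boolNot
  r₁ := Equiv.boolNot
  r₂ := 1
  sq₀ := by decide
  sq₁ := by decide
  sq₂ := by decide
  sq₀₂ := by decide

/-- `𝒩(3)`: an edge across a closed disc, joining two boundary vertices.  A flag stabiliser is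
generated by `R₁`, `R₁^R₀`, `R₁^R₂`, `R₁^(R₀R₂)`. -/
def basicThree : FlagMap (Bool × Bool) where
  r₀ := flip₁
  r₁ := 1
  r₂ := flip₂
  sq₀ := by decide
  sq₁ := by decide
  sq₂ := by decide
  sq₀₂ := by decide

/-- `𝒩(4)`: an edge in a closed disc, joining an interior vertex (with flags `(true, _)`) to a boundary
vertex (with flags `(false, _)`).  The stabiliser of the flag `(false, false)` is generated by `R₁`,
`R₁^R₂`, `(R₁R₂)^R₀`. -/
def basicFour : FlagMap (Bool × Bool) where
  r₀ := flip₁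
  r₁ := Equiv.swap (true, false) (true, true)
  r₂ := flip₂
  sq₀ := by decide
  sq₁ := by decide
  sq₂ := by decide
  sq₀₂ := by decide

/-- `𝒩(5)`: an edge joining two vertices in the sphere.  A flag stabiliser is generated by `R₁R₂` and
`(R₁R₂)^R₀`. -/
def basicFive : FlagMap (Bool × Bool) where
  r₀ := flip₁
  r₁ := flip₂
  r₂ := flip₂
  sq₀ := by decide
  sq₁ := by decide
  sq₂ := by decide
  sq₀₂ := by decide

/-- The basic map `𝒩(T)`, the map with one edge labelling the class `T`.  The map `𝒩(1)` has a
single flag. -/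
def basicMap : (T : EdgeTransitiveClass) → FlagMap T.BasicFlags
  | one => ⟨1, 1, 1, one_pow 2, one_pow 2, one_pow 2, by decide⟩
  | two σ => σ.op basicTwo
  | twoEx σ => σ.op basicTwoEx
  | three => basicThree
  | four σ => σ.op basicFour
  | five σ => σ.op basicFive

/-- `M ∈ T`: the map `M` is connected and edge-transitive, and `M / Aut M ≅ 𝒩(T)`. -/
def Contains {Φ : Type u} (T : EdgeTransitiveClass) (M : FlagMap Φ) : Prop :=
  M.Connected ∧ M.EdgeTransitive ∧ M.quotient.Isomorphic T.basicMap

/-- `G ∈ 𝒢(T)`: the group `G` is isomorphic to `Aut M` for some map `M ∈ T`.  A connected map has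
countably many flags, so it loses nothing to take the flags in `Type`. -/
def Realises (T : EdgeTransitiveClass) (G : Type u) [Group G] : Prop :=
  ∃ (Φ : Type) (M : FlagMap Φ), T.Contains M ∧ Nonempty (G ≃* M.aut)

end EdgeTransitiveClass

/-!
Let `N` be a one-edge map. Every map `M` with `M / Aut M ≅ N` and `Aut M ≅ G` is the covering of
`N` given by a voltage assignment, that is, by elements of `G` attached to the sides of the flags
of `N`. Conversely, a voltage assignment whose voltages generate `G` gives a map of this kind
unless the covering map has automorphisms other than the translations by `G`.

For `N = 𝒩(1)` there can be no others, so `G ∈ 𝒢(1)` if and only if `G` is generated by elements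
`a, b, c` with `a² = b² = c² = 1` and `ac = ca`. For `𝒩(2)`, `𝒩(3)` and `𝒩(4)`, voltages are built
from involutions `x, y, z` that generate `G`, where the order of `zy` does not divide that of
`zx`; then closed walks at one flag of `N` tell its fibre from all others. For `𝒩(2 ex)` and
`𝒩(5)` the voltages amount to two generators of `G`, and an automorphism of `G` inverting both
gives an additional automorphism of the map. In `L₂(q)` every generating pair, represented by
matrices `A` and `B`, is inverted in this way by conjugation with `AB - BA`. Duality and Petrie
duality do not change the automorphism group, so the superscripts play no role.

For most `q` the generators of `L₂(q)` are found from the observation that a subgroup of `SL₂(q)`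
containing the diagonal torus and a matrix without zero entries is the whole group: since there
are only two classes of nonzero elements modulo squares, two conjugates of torus elements have a
nontrivial unipotent quotient up to the torus. Small `q` are treated with explicit matrices. For
`q = 7` and `q = 9`, suppose that `L₂(q)` is generated by `a, b, c` as above. Lifts of `a` and `c`
anticommute and make the traceless matrices a three-dimensional space of pure quaternions, on
which `a`, `c` and `b` act as the half-turns about `e₁`, `e₂` and some unit vector `w`. These
half-turns always permute fewer than `q` non-isotropic lines (axes of a dihedral group, an
octahedral frame, or an icosahedron), whereas the orbit of such a line under the unipotent
matrices alone has `q` elements.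
-/

universe v w

namespace FlagMap

variable {Φ : Type u} {X : Type v} {G : Type w} [Group G] {M : FlagMap Φ} {N : FlagMap X}

theorem r₀_mem_mon : M.r₀ ∈ M.mon := Subgroup.subset_closure (by simp)

theorem r₁_mem_mon : M.r₁ ∈ M.mon := Subgroup.subset_closure (by simp)

theorem r₂_mem_mon : M.r₂ ∈ M.mon := Subgroup.subset_closure (by simp)

theorem r₀_mem_edgeGroup : M.r₀ ∈ M.edgeGroup := Subgroup.subset_closure (by simp)

theorem r₂_mem_edgeGroup : M.r₂ ∈ M.edgeGroup := Subgroup.subset_closure (by simp)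

theorem edgeGroup_le_mon : M.edgeGroup ≤ M.mon :=
  Subgroup.closure_mono (by simp [Set.insert_subset_iff])

theorem r₀_r₀ (x : Φ) : M.r₀ (M.r₀ x) = x := DFunLike.congr_fun M.sq₀ x

theorem r₁_r₁ (x : Φ) : M.r₁ (M.r₁ x) = x := DFunLike.congr_fun M.sq₁ x

theorem r₂_r₂ (x : Φ) : M.r₂ (M.r₂ x) = x := DFunLike.congr_fun M.sq₂ x

theorem r₂_r₀ (x : Φ) : M.r₂ (M.r₀ x) = M.r₀ (M.r₂ x) := by
  have h : M.r₀ (M.r₂ (M.r₀ (M.r₂ (M.r₂ (M.r₀ x))))) = M.r₂ (M.r₀ x) :=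
    DFunLike.congr_fun M.sq₀₂ (M.r₂ (M.r₀ x))
  rw [← h, r₂_r₂, r₀_r₀]

theorem apply_eq_of_mem_aut {a g : Equiv.Perm Φ} (ha : a ∈ M.aut) (hg : g ∈ M.mon) (x : Φ) :
    g (a x) = a (g x) :=
  DFunLike.congr_fun (Subgroup.mem_centralizer_iff.mp ha g hg) x

theorem mem_aut_iff {a : Equiv.Perm Φ} :
    a ∈ M.aut ↔ (∀ x, M.r₀ (a x) = a (M.r₀ x)) ∧ (∀ x, M.r₁ (a x) = a (M.r₁ x)) ∧
      ∀ x, M.r₂ (a x) = a (M.r₂ x) := by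
  rw [aut, mon, Subgroup.centralizer_closure, Subgroup.mem_centralizer_iff]
  simp only [Set.mem_insert_iff, Set.mem_singleton_iff, forall_eq_or_imp, forall_eq]
  simp only [Equiv.ext_iff, Equiv.Perm.mul_apply]

theorem Connected.induction (hM : M.Connected) {P : Φ → Prop} {x₀ : Φ} (base : P x₀)
    (step₀ : ∀ x, P x → P (M.r₀ x)) (step₁ : ∀ x, P x → P (M.r₁ x))
    (step₂ : ∀ x, P x → P (M.r₂ x)) (x : Φ) : P x := by
  have inv {r : Equiv.Perm Φ} (hr : ∀ x, r (r x) = x) : r⁻¹ = r :=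
    inv_eq_of_mul_eq_one_left (Equiv.ext hr)
  have invariant : ∀ g ∈ M.mon, ∀ x, P x → P (g x) := by
    intro g hg
    induction hg using Subgroup.closure_induction'' with
    | mem g hg => rcases hg with rfl | rfl | rfl <;> assumption
    | inv_mem g hg =>
      rcases hg with rfl | rfl | rfl
      · rwa [inv r₀_r₀]
      · rwa [inv r₁_r₁]
      · rwa [inv r₂_r₂]
    | one => exact fun x hx => hx
    | mul _ _ _ _ hg hh => exact fun x hx => hg _ (hh x hx)
  obtain ⟨g, hg, rfl⟩ := hM.2 x₀ x
  exact invariant g hg x₀ base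

theorem Connected.aut_ext (hM : M.Connected) {a b : Equiv.Perm Φ} (ha : a ∈ M.aut)
    (hb : b ∈ M.aut) {x₀ : Φ} (h : a x₀ = b x₀) : a = b := by
  ext x
  obtain ⟨g, hg, rfl⟩ := hM.2 x₀ x
  rw [← apply_eq_of_mem_aut ha hg, ← apply_eq_of_mem_aut hb hg, h]

/-- `f` presents `N` as the quotient `M / Aut M`. -/
structure IsAutQuotient (M : FlagMap Φ) (N : FlagMap X) (f : Φ → X) : Prop where
  surjective : f.Surjective
  map_r₀ : ∀ x, f (M.r₀ x) = N.r₀ (f x)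
  map_r₁ : ∀ x, f (M.r₁ x) = N.r₁ (f x)
  map_r₂ : ∀ x, f (M.r₂ x) = N.r₂ (f x)
  eq_iff : ∀ x y, f x = f y ↔ ∃ a ∈ M.aut, a y = x

theorem quotient_isomorphic_iff : M.quotient.Isomorphic N ↔ ∃ f, M.IsAutQuotient N f := by
  have mk_eq_iff (x y : Φ) : (⟦x⟧ : M.QuotientFlags) = ⟦y⟧ ↔ ∃ a ∈ M.aut, a y = x := by
    rw [Quotient.eq, MulAction.orbitRel_apply, MulAction.mem_orbit_iff, Subtype.exists]
    simp only [exists_prop, Subgroup.mk_smul, Equiv.Perm.smul_def]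
  constructor
  · rintro ⟨e, h₀, h₁, h₂⟩
    exact ⟨fun x => e ⟦x⟧, e.surjective.comp Quotient.mk_surjective, fun x => h₀ ⟦x⟧,
      fun x => h₁ ⟦x⟧, fun x => h₂ ⟦x⟧, fun x y => by rw [e.injective.eq_iff, mk_eq_iff]⟩
  · rintro ⟨f, hf⟩
    let e : M.QuotientFlags → X := Quotient.lift f fun x y h =>
      (hf.eq_iff x y).mpr ((mk_eq_iff x y).mp (Quotient.sound h))
    have he : e.Bijective := by
      refine ⟨fun p q h => ?_, fun x => (hf.surjective x).imp' (Quotient.mk _) fun _ h => h⟩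
      induction p, q using Quotient.inductionOn₂ with
      | _ x y => exact (mk_eq_iff x y).mpr ((hf.eq_iff x y).mp h)
    refine ⟨Equiv.ofBijective e he, fun p => ?_, fun p => ?_, fun p => ?_⟩ <;>
      induction p using Quotient.inductionOn with | _ x => ?_
    exacts [hf.map_r₀ x, hf.map_r₁ x, hf.map_r₂ x]

section Duality

theorem mon_dual : M.dual.mon = M.mon := by
  rw [mon, mon, dual, Set.insert_comm, Set.pair_comm, Set.insert_comm]

theorem edgeGroup_dual : M.dual.edgeGroup = M.edgeGroup := by
  simp only [edgeGroup, dual, Set.pair_comm]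

theorem aut_dual : M.dual.aut = M.aut := by
  rw [aut, mon_dual, aut]

theorem petrie_petrie : M.petrie.petrie = M := by
  have h : M.r₀ * M.r₂ * M.r₂ = M.r₀ := by rw [mul_assoc, ← sq, M.sq₂, mul_one]
  cases M
  simpa only [petrie, FlagMap.mk.injEq, and_true] using h

theorem mon_petrie : M.petrie.mon = M.mon := by
  have le (L : FlagMap Φ) : L.petrie.mon ≤ L.mon := by
    rw [mon, Subgroup.closure_le]
    rintro _ (rfl | rfl | rfl)
    exacts [mul_mem r₀_mem_mon r₂_mem_mon, r₁_mem_mon, r₂_mem_mon]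
  exact (le M).antisymm (by simpa only [petrie_petrie] using le M.petrie)

theorem edgeGroup_petrie : M.petrie.edgeGroup = M.edgeGroup := by
  have le (L : FlagMap Φ) : L.petrie.edgeGroup ≤ L.edgeGroup := by
    rw [edgeGroup, Subgroup.closure_le]
    rintro _ (rfl | rfl)
    exacts [mul_mem r₀_mem_edgeGroup r₂_mem_edgeGroup, r₂_mem_edgeGroup]
  exact (le M).antisymm (by simpa only [petrie_petrie] using le M.petrie)

theorem aut_petrie : M.petrie.aut = M.aut := by
  rw [aut, mon_petrie, aut]

/-- `G` is the automorphism group of a connected edge-transitive map with quotient `N`.  This is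
membership in `𝒢(T)` with the basic map `𝒩(T)` replaced by an arbitrary map `N`. -/
def RealisedOver (N : FlagMap X) (G : Type w) [Group G] : Prop :=
  ∃ (Φ : Type) (M : FlagMap Φ), M.Connected ∧ M.EdgeTransitive ∧ (∃ f, M.IsAutQuotient N f) ∧
    Nonempty (G ≃* M.aut)

theorem RealisedOver.of_mulEquiv {H : Type*} [Group H] (h : N.RealisedOver G) (e : H ≃* G) :
    N.RealisedOver H := by
  obtain ⟨Φ, M, hc, he, hf, ⟨i⟩⟩ := h
  exact ⟨Φ, M, hc, he, hf, ⟨e.trans i⟩⟩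

theorem RealisedOver.dual (h : N.RealisedOver G) : N.dual.RealisedOver G := by
  obtain ⟨Φ, M, hc, he, ⟨f, hf⟩, ⟨i⟩⟩ := h
  refine ⟨Φ, M.dual, ?_, ?_, ⟨f, hf.surjective, hf.map_r₂, hf.map_r₁, hf.map_r₀, ?_⟩,
    ⟨i.trans (MulEquiv.subgroupCongr aut_dual.symm)⟩⟩
  · rwa [Connected, mon_dual]
  · rwa [EdgeTransitive, aut_dual, edgeGroup_dual]
  · rw [aut_dual]; exact hf.eq_iff

theorem RealisedOver.petrie (h : N.RealisedOver G) : N.petrie.RealisedOver G := by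
  obtain ⟨Φ, M, hc, he, ⟨f, hf⟩, ⟨i⟩⟩ := h
  refine ⟨Φ, M.petrie, ?_, ?_, ⟨f, hf.surjective, fun x => ?_, hf.map_r₁, hf.map_r₂, ?_⟩,
    ⟨i.trans (MulEquiv.subgroupCongr aut_petrie.symm)⟩⟩
  · rwa [Connected, mon_petrie]
  · rwa [EdgeTransitive, aut_petrie, edgeGroup_petrie]
  · exact (hf.map_r₀ _).trans (congrArg N.r₀ (hf.map_r₂ x))
  · rw [aut_petrie]; exact hf.eq_iff

theorem realisedOver_op_iff {X : Type} {N : FlagMap X} (σ : ClassSuperscript) :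
    (σ.op N).RealisedOver G ↔ N.RealisedOver G := by
  cases σ with
  | empty => exact Iff.rfl
  | star => exact ⟨fun h => h.dual, fun h => h.dual⟩
  | P =>
    refine ⟨fun h => ?_, fun h => h.dual.petrie⟩
    have h' : N.dual.petrie.petrie.RealisedOver G := RealisedOver.petrie h
    rw [petrie_petrie] at h'
    exact h'.dual

end Duality

end FlagMap

theorem EdgeTransitiveClass.realises_iff {G : Type u} [Group G] {T : EdgeTransitiveClass} :
    T.Realises G ↔ T.basicMap.RealisedOver G := by
  simp only [Realises, Contains, FlagMap.quotient_isomorphic_iff, FlagMap.RealisedOver, and_assoc]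

namespace FlagMap

/-- A voltage assignment on `N` with values in `G`: crossing the `rᵢ`-side of the flag `x`
multiplies by `cᵢ x` on the right.  The laws make the relations of the `rᵢ` lift to `X × G`. -/
structure Voltage {X : Type v} (N : FlagMap X) (G : Type w) [Group G] where
  c₀ : X → G
  c₁ : X → G
  c₂ : X → G
  c₀_mul : ∀ x, c₀ x * c₀ (N.r₀ x) = 1
  c₁_mul : ∀ x, c₁ x * c₁ (N.r₁ x) = 1
  c₂_mul : ∀ x, c₂ x * c₂ (N.r₂ x) = 1
  comm : ∀ x, c₀ x * c₂ (N.r₀ x) = c₂ x * c₀ (N.r₂ x)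

namespace Voltage

variable {X : Type v} {N : FlagMap X} {G : Type w} [Group G] (V : N.Voltage G)

/-- The covering map of `N` derived from the voltage assignment `V`. -/
def cover : FlagMap (X × G) where
  r₀ := Equiv.prodShear N.r₀ fun x => Equiv.mulRight (V.c₀ x)
  r₁ := Equiv.prodShear N.r₁ fun x => Equiv.mulRight (V.c₁ x)
  r₂ := Equiv.prodShear N.r₂ fun x => Equiv.mulRight (V.c₂ x)
  sq₀ := by
    ext ⟨x, g⟩ : 1
    simp [sq, r₀_r₀, mul_assoc, V.c₀_mul]
  sq₁ := by
    ext ⟨x, g⟩ : 1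
    simp [sq, r₁_r₁, mul_assoc, V.c₁_mul]
  sq₂ := by
    ext ⟨x, g⟩ : 1
    simp [sq, r₂_r₂, mul_assoc, V.c₂_mul]
  sq₀₂ := by
    ext ⟨x, g⟩ : 1
    have voltage_eq_one : V.c₂ x * V.c₀ (N.r₂ x) * (V.c₂ (N.r₀ (N.r₂ x)) * V.c₀ (N.r₀ x)) = 1 := by
      have h := V.c₂_mul (N.r₀ x)
      rw [r₂_r₀] at h
      rw [← V.comm, mul_assoc, ← mul_assoc (V.c₂ (N.r₀ x)), h, one_mul, V.c₀_mul]
    simpa [sq, r₂_r₀, r₂_r₂, r₀_r₀, mul_assoc] using voltage_eq_one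

theorem cover_r₀ (x : X) (g : G) : V.cover.r₀ (x, g) = (N.r₀ x, g * V.c₀ x) := rfl

theorem cover_r₁ (x : X) (g : G) : V.cover.r₁ (x, g) = (N.r₁ x, g * V.c₁ x) := rfl

theorem cover_r₂ (x : X) (g : G) : V.cover.r₂ (x, g) = (N.r₂ x, g * V.c₂ x) := rfl

/-- The automorphism `(x, g) ↦ (x, h g)` of the covering map. -/
def translation : G →* V.cover.aut where
  toFun h := ⟨Equiv.prodCongr (Equiv.refl X) (Equiv.mulLeft h), mem_aut_iff.mpr
    ⟨fun _ => by simp [cover, mul_assoc], fun _ => by simp [cover, mul_assoc],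
      fun _ => by simp [cover, mul_assoc]⟩⟩
  map_one' := by ext x <;> simp
  map_mul' g h := by ext x <;> simp [mul_assoc]

theorem translation_apply (h : G) (x : X) (g : G) : (V.translation h).1 (x, g) = (x, h * g) := rfl

variable {V}

theorem apply_of_mem_mon {p : Equiv.Perm (X × G)} (hp : p ∈ V.cover.mon) {x y : X} {h : G}
    (hx : p (x, 1) = (y, h)) (g : G) : p (x, g) = (y, g * h) := by
  have key := apply_eq_of_mem_aut (V.translation g).2 hp (x, 1)
  rwa [hx, translation_apply, translation_apply, mul_one] at key

theorem pow_apply_of_mem_mon {p : Equiv.Perm (X × G)} (hp : p ∈ V.cover.mon) {x : X} {h : G}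
    (hx : p (x, 1) = (x, h)) (n : ℕ) : (p ^ n) (x, 1) = (x, h ^ n) := by
  induction n with
  | zero => simp
  | succ n ih => rw [pow_succ', Equiv.Perm.mul_apply, ih, apply_of_mem_mon hp hx, ← pow_succ]

theorem exists_separating_of_pow {p : Equiv.Perm (X × G)} (hp : p ∈ V.cover.mon) {x y : X} {g h : G}
    (hx : p (x, 1) = (x, g)) (hy : p (y, 1) = (y, h)) {n : ℕ} (hg : g ^ n = 1) (hh : h ^ n ≠ 1) :
    ∃ q ∈ V.cover.mon, q (x, 1) = (x, 1) ∧ q (y, 1) ≠ (y, 1) := by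
  refine ⟨p ^ n, pow_mem hp n, ?_, ?_⟩
  · rw [pow_apply_of_mem_mon hp hx, hg]
  · rw [pow_apply_of_mem_mon hp hy]
    exact fun h => hh (congrArg Prod.snd h)

variable (V) in
/-- The local voltage group at `x`: the voltages of the closed walks based at `x`. -/
def localGroup (x : X) : Subgroup G where
  carrier := {g | ∃ p ∈ V.cover.mon, p (x, 1) = (x, g)}
  one_mem' := ⟨1, one_mem _, rfl⟩
  mul_mem' := by
    rintro g h ⟨p, hp, hpx⟩ ⟨q, hq, hqx⟩
    exact ⟨q * p, mul_mem hq hp, by rw [Equiv.Perm.mul_apply, hpx, apply_of_mem_mon hq hqx]⟩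
  inv_mem' := by
    rintro g ⟨p, hp, hpx⟩
    refine ⟨p⁻¹, inv_mem hp, ?_⟩
    rw [Equiv.Perm.inv_eq_iff_eq, apply_of_mem_mon hp hpx, inv_mul_cancel]

section Realisation

variable {x₀ : X} (edge : ∀ x, ∃ p ∈ V.cover.edgeGroup, (p (x, 1)).1 = x₀)
  (loops : V.localGroup x₀ = ⊤)
  (separated : ∀ x ≠ x₀, ∃ p ∈ V.cover.mon, p (x₀, 1) = (x₀, 1) ∧ p (x, 1) ≠ (x, 1))

include edge

theorem exists_edgeGroup_apply_eq (z : X × G) : ∃ p ∈ V.cover.edgeGroup, ∃ g, p z = (x₀, g) := by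
  obtain ⟨x, g⟩ := z
  obtain ⟨p, hp, rfl⟩ := edge x
  exact ⟨p, hp, _, apply_of_mem_mon (edgeGroup_le_mon hp) rfl g⟩

theorem cover_edgeTransitive : V.cover.EdgeTransitive := by
  intro z z'
  obtain ⟨p, hp, g, hpz⟩ := exists_edgeGroup_apply_eq edge z
  obtain ⟨q, hq, h, hqz⟩ := exists_edgeGroup_apply_eq edge z'
  refine ⟨_, (V.translation (h * g⁻¹)).2, q⁻¹ * p, mul_mem (inv_mem hq) hp, ?_⟩
  rw [Equiv.Perm.mul_apply, Equiv.Perm.inv_eq_iff_eq,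
    apply_eq_of_mem_aut (V.translation _).2 (edgeGroup_le_mon hp), hpz, hqz, translation_apply,
    inv_mul_cancel_right]

include loops

theorem cover_connected : V.cover.Connected := by
  have to_base (z : X × G) : ∃ p ∈ V.cover.mon, p z = (x₀, 1) := by
    obtain ⟨p, hp, g, hpz⟩ := exists_edgeGroup_apply_eq edge z
    obtain ⟨q, hq, hqx⟩ : g⁻¹ ∈ V.localGroup x₀ := loops ▸ Subgroup.mem_top _
    refine ⟨q * p, mul_mem hq (edgeGroup_le_mon hp), ?_⟩
    rw [Equiv.Perm.mul_apply, hpz, apply_of_mem_mon hq hqx, mul_inv_cancel]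
  refine ⟨⟨(x₀, 1)⟩, fun z z' => ?_⟩
  obtain ⟨p, hp, hpz⟩ := to_base z
  obtain ⟨q, hq, hqz⟩ := to_base z'
  exact ⟨q⁻¹ * p, mul_mem (inv_mem hq) hp, by
    rw [Equiv.Perm.mul_apply, hpz, Equiv.Perm.inv_eq_iff_eq, hqz]⟩

include separated

theorem translation_surjective : Function.Surjective V.translation := by
  intro a
  set x := (a.1 (x₀, 1)).1
  set g := (a.1 (x₀, 1)).2
  have hb : (a⁻¹ * V.translation g).1 (x, 1) = (x₀, 1) := by
    change a.1⁻¹ ((V.translation g).1 (x, 1)) = _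
    rw [Equiv.Perm.inv_eq_iff_eq, translation_apply, mul_one]
  have hx : x = x₀ := by
    by_contra hne
    obtain ⟨p, hp, hp₀, hpx⟩ := separated x hne
    refine hpx ((a⁻¹ * V.translation g).1.injective ?_)
    rw [← apply_eq_of_mem_aut (Subtype.prop _) hp, hb, hp₀]
  rw [hx] at hb
  have hone := (cover_connected edge loops).aut_ext (Subtype.prop _) (one_mem _) hb
  exact ⟨g, (inv_mul_eq_one.mp (Subtype.ext hone)).symm⟩

end Realisation

/-- `separated` keeps an automorphism from moving `(x₀, 1)` out of the fibre over `x₀`, so the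
translations are all the automorphisms. -/
theorem realisedOver {G : Type} [Group G] {X : Type} {N : FlagMap X} {V : N.Voltage G} {x₀ : X}
    (edge : ∀ x, ∃ p ∈ V.cover.edgeGroup, (p (x, 1)).1 = x₀) (loops : V.localGroup x₀ = ⊤)
    (separated : ∀ x ≠ x₀, ∃ p ∈ V.cover.mon, p (x₀, 1) = (x₀, 1) ∧ p (x, 1) ≠ (x, 1)) :
    N.RealisedOver G := by
  have surjective := translation_surjective edge loops separated
  have injective : Function.Injective V.translation := fun g h hgh => by
    have key := congrArg (fun a : V.cover.aut => a.1 (x₀, 1)) hgh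
    simpa only [translation_apply, mul_one, Prod.mk.injEq, true_and] using key
  refine ⟨X × G, V.cover, cover_connected edge loops, cover_edgeTransitive edge,
    ⟨Prod.fst, Prod.fst_surjective, fun _ => rfl, fun _ => rfl, fun _ => rfl, ?_⟩,
    ⟨MulEquiv.ofBijective V.translation ⟨injective, surjective⟩⟩⟩
  rintro ⟨x, g⟩ ⟨y, h⟩
  constructor
  · rintro rfl
    exact ⟨_, (V.translation (g * h⁻¹)).2, by rw [translation_apply, inv_mul_cancel_right]⟩
  · rintro ⟨a, ha, hxy⟩
    obtain ⟨k, hk⟩ := surjective ⟨a, ha⟩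
    rw [← Subtype.coe_mk a ha, ← hk, translation_apply] at hxy
    exact (congrArg Prod.fst hxy).symm

end Voltage

end FlagMap

section Generation

variable (G : Type u) [Group G]

/-- `G` is a quotient of the group `⟨R₀, R₁, R₂ ∣ Rᵢ² = (R₀R₂)² = 1⟩`, which acts on the flags of
every map; these are the automorphism groups of the maps in class `1`. -/
def GeneratedByFlagReflections : Prop :=
  ∃ a b c : G, a * a = 1 ∧ b * b = 1 ∧ c * c = 1 ∧ a * c = c * a ∧ Subgroup.closure {a, b, c} = ⊤

/-- `G` is generated by involutions `x`, `y`, `z` such that the order of `zy` does not divide that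
of `zx`.  The asymmetry between `x` and `y` rules out the automorphisms that would put the maps
constructed below into a class with fewer orbits on flags. -/
def GeneratedByAsymmetricInvolutions : Prop :=
  ∃ x y z : G, x * x = 1 ∧ y * y = 1 ∧ z * z = 1 ∧ x ≠ 1 ∧ y ≠ 1 ∧ z ≠ 1 ∧
    Subgroup.closure {x, y, z} = ⊤ ∧ ∃ n : ℕ, (z * x) ^ n = 1 ∧ (z * y) ^ n ≠ 1

/-- Both members of every generating pair of `G` are inverted by a common automorphism. -/
def GeneratingPairsInvertible : Prop :=
  ∀ a b : G, Subgroup.closure {a, b} = ⊤ → ∃ α : G ≃* G, α a = a⁻¹ ∧ α b = b⁻¹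

variable {G} {H : Type v} [Group H]

theorem closure_image_eq_top_of_mulEquiv (e : G ≃* H) {s : Set G} (hs : Subgroup.closure s = ⊤) :
    Subgroup.closure (e '' s) = ⊤ := by
  have h := e.toMonoidHom.map_closure s
  rw [hs, Subgroup.map_top_of_surjective _ e.surjective] at h
  exact h.symm

theorem GeneratedByFlagReflections.of_mulEquiv (h : GeneratedByFlagReflections G) (e : G ≃* H) :
    GeneratedByFlagReflections H := by
  obtain ⟨a, b, c, ha, hb, hc, hac, hgen⟩ := h
  have hgen' := closure_image_eq_top_of_mulEquiv e hgen
  rw [Set.image_insert_eq, Set.image_pair] at hgen'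
  refine ⟨e a, e b, e c, ?_, ?_, ?_, ?_, hgen'⟩
  · rw [← map_mul, ha, map_one]
  · rw [← map_mul, hb, map_one]
  · rw [← map_mul, hc, map_one]
  · rw [← map_mul, ← map_mul, hac]

theorem GeneratedByAsymmetricInvolutions.of_mulEquiv (h : GeneratedByAsymmetricInvolutions G)
    (e : G ≃* H) : GeneratedByAsymmetricInvolutions H := by
  obtain ⟨x, y, z, hx, hy, hz, hx₁, hy₁, hz₁, hgen, n, hzx, hzy⟩ := h
  have hgen' := closure_image_eq_top_of_mulEquiv e hgen
  rw [Set.image_insert_eq, Set.image_pair] at hgen'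
  refine ⟨e x, e y, e z, ?_, ?_, ?_, ?_, ?_, ?_, hgen', n, ?_, ?_⟩
  · rw [← map_mul, hx, map_one]
  · rw [← map_mul, hy, map_one]
  · rw [← map_mul, hz, map_one]
  · rwa [ne_eq, EmbeddingLike.map_eq_one_iff]
  · rwa [ne_eq, EmbeddingLike.map_eq_one_iff]
  · rwa [ne_eq, EmbeddingLike.map_eq_one_iff]
  · rw [← map_mul, ← map_pow, hzx, map_one]
  · rwa [← map_mul, ← map_pow, ne_eq, EmbeddingLike.map_eq_one_iff]

theorem mul_pow_eq_one_comm (a b : G) (n : ℕ) : (a * b) ^ n = 1 ↔ (b * a) ^ n = 1 := by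
  have semiconj : SemiconjBy a ((b * a) ^ n) ((a * b) ^ n) :=
    SemiconjBy.pow_right (mul_assoc a b a).symm n
  constructor <;> intro h <;> rw [h] at semiconj
  · exact (mul_eq_left.mp (semiconj.eq.trans (one_mul a)))
  · exact (mul_eq_right.mp (semiconj.eq.symm.trans (mul_one a)))

end Generation

namespace EdgeTransitiveClass

open FlagMap FlagMap.Voltage

section Realisations

variable {G : Type} [Group G]

theorem realisedOver_basicMap_one (h : GeneratedByFlagReflections G) :
    (basicMap one).RealisedOver G := by
  obtain ⟨a, b, c, ha, hb, hc, hac, hgen⟩ := h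
  let V : (basicMap one).Voltage G :=
    ⟨fun _ => a, fun _ => b, fun _ => c, fun _ => ha, fun _ => hb, fun _ => hc, fun _ => hac⟩
  refine realisedOver (V := V) (x₀ := ()) (fun _ => ⟨1, one_mem _, rfl⟩) ?_ fun _ h => absurd rfl h
  rw [eq_top_iff, ← hgen, Subgroup.closure_le]
  rintro _ (rfl | rfl | rfl)
  exacts [⟨_, r₀_mem_mon, congrArg _ (one_mul _)⟩, ⟨_, r₁_mem_mon, congrArg _ (one_mul _)⟩,
    ⟨_, r₂_mem_mon, congrArg _ (one_mul _)⟩]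

theorem realisedOver_basicTwo (h : GeneratedByAsymmetricInvolutions G) :
    basicTwo.RealisedOver G := by
  obtain ⟨x, y, z, hx, hy, hz, -, -, -, hgen, n, hzx, hzy⟩ := h
  let V : basicTwo.Voltage G :=
    { c₀ := 1
      c₁ := fun p => cond p y x
      c₂ := fun _ => z
      c₀_mul := by simp
      c₁_mul := by simp [basicTwo, hx, hy]
      c₂_mul := by simp [hz]
      comm := by simp }
  have r₁_mul_r₂ (p : Bool) : (V.cover.r₁ * V.cover.r₂) (p, 1) = (p, z * cond p y x) := by
    simp [cover_r₁, cover_r₂, V, basicTwo]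
  have mem : V.cover.r₁ * V.cover.r₂ ∈ V.cover.mon := mul_mem r₁_mem_mon r₂_mem_mon
  refine realisedOver (V := V) (x₀ := false) ?_ ?_ ?_
  · rintro (_ | _)
    exacts [⟨1, one_mem _, rfl⟩, ⟨_, r₀_mem_edgeGroup, rfl⟩]
  · rw [eq_top_iff, ← hgen, Subgroup.closure_le]
    rintro _ (rfl | rfl | rfl)
    · exact ⟨_, r₁_mem_mon, by simp [cover_r₁, V, basicTwo]⟩
    · exact ⟨_, mul_mem r₀_mem_mon (mul_mem r₁_mem_mon r₀_mem_mon), by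
        simp [cover_r₀, cover_r₁, V, basicTwo]⟩
    · exact ⟨_, r₂_mem_mon, by simp [cover_r₂, V, basicTwo]⟩
  · rintro (_ | _) hp
    · exact absurd rfl hp
    · exact exists_separating_of_pow mem (r₁_mul_r₂ _) (r₁_mul_r₂ _) hzx hzy

theorem realisedOver_basicThree (h : GeneratedByAsymmetricInvolutions G) :
    basicThree.RealisedOver G := by
  obtain ⟨x, y, z, hx, hy, hz, hx₁, hy₁, hz₁, hgen, -⟩ := h
  let V : basicThree.Voltage G :=
    { c₀ := 1
      c₁ := fun p => cond p.1 (cond p.2 z y) (cond p.2 x 1)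
      c₂ := 1
      c₀_mul := by simp
      c₁_mul := by simp [basicThree, hx, hy, hz]
      c₂_mul := by simp
      comm := by simp }
  refine realisedOver (V := V) (x₀ := (false, false)) ?_ ?_ ?_
  · rintro ⟨_ | _, _ | _⟩
    exacts [⟨1, one_mem _, rfl⟩, ⟨_, r₂_mem_edgeGroup, rfl⟩, ⟨_, r₀_mem_edgeGroup, rfl⟩,
      ⟨_, mul_mem r₀_mem_edgeGroup r₂_mem_edgeGroup, rfl⟩]
  · rw [eq_top_iff, ← hgen, Subgroup.closure_le]
    rintro _ (rfl | rfl | rfl)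
    · exact ⟨_, mul_mem r₂_mem_mon (mul_mem r₁_mem_mon r₂_mem_mon), by
        simp [cover_r₁, cover_r₂, V, basicThree, flip₂]⟩
    · exact ⟨_, mul_mem r₀_mem_mon (mul_mem r₁_mem_mon r₀_mem_mon), by
        simp [cover_r₀, cover_r₁, V, basicThree, flip₁]⟩
    · exact ⟨_, mul_mem (mul_mem r₂_mem_mon r₀_mem_mon)
        (mul_mem r₁_mem_mon (mul_mem r₀_mem_mon r₂_mem_mon)), by
        simp [cover_r₀, cover_r₁, cover_r₂, V, basicThree, flip₁, flip₂]⟩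
  · intro p hp
    refine ⟨_, r₁_mem_mon, by simp [cover_r₁, V, basicThree], ?_⟩
    revert hp
    obtain ⟨_ | _, _ | _⟩ := p <;> simp [cover_r₁, V, basicThree, hx₁, hy₁, hz₁]

theorem realisedOver_basicFour (h : GeneratedByAsymmetricInvolutions G) :
    basicFour.RealisedOver G := by
  obtain ⟨x, y, z, hx, hy, hz, -, -, -, hgen, n, hzx, hzy⟩ := h
  let V : basicFour.Voltage G :=
    { c₀ := 1
      c₁ := fun p => cond p.1 z (cond p.2 y x)
      c₂ := 1
      c₀_mul := by simp
      c₁_mul := by simp [basicFour, Equiv.swap_apply_def, hx, hy, hz]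
      c₂_mul := by simp
      comm := by simp }
  -- `u` goes across the edge to the vertex with flags `(true, _)`, around it, and back.
  let u := V.cover.r₀ * V.cover.r₂ * V.cover.r₁ * V.cover.r₀
  have hu : u ∈ V.cover.mon :=
    mul_mem (mul_mem (mul_mem r₀_mem_mon r₂_mem_mon) r₁_mem_mon) r₀_mem_mon
  have hr₁u : V.cover.r₁ * u ∈ V.cover.mon := mul_mem r₁_mem_mon hu
  have hur₁ : u * V.cover.r₁ ∈ V.cover.mon := mul_mem hu r₁_mem_mon
  have values : u ((false, false), 1) = ((false, false), z) ∧
      (V.cover.r₁ * u) ((false, false), 1) = ((false, false), z * x) ∧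
      (u * V.cover.r₁) ((false, false), 1) = ((false, false), x * z) ∧
      (u * V.cover.r₁) ((false, true), 1) = ((false, true), y * z) ∧
      (u * V.cover.r₁) ((true, false), 1) = ((true, false), z * y) ∧
      (V.cover.r₁ * u) ((true, true), 1) = ((true, true), y * z) := by
    simp [u, cover_r₀, cover_r₁, cover_r₂, V, basicFour, flip₁, flip₂, Equiv.swap_apply_def]
  obtain ⟨u_ff, r₁u_ff, ur₁_ff, ur₁_ft, ur₁_tf, r₁u_tt⟩ := values
  have hxz : (x * z) ^ n = 1 := (mul_pow_eq_one_comm x z n).mpr hzx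
  have hyz : (y * z) ^ n ≠ 1 := fun h => hzy ((mul_pow_eq_one_comm y z n).mp h)
  refine realisedOver (V := V) (x₀ := (false, false)) ?_ ?_ ?_
  · rintro ⟨_ | _, _ | _⟩
    exacts [⟨1, one_mem _, rfl⟩, ⟨_, r₂_mem_edgeGroup, rfl⟩, ⟨_, r₀_mem_edgeGroup, rfl⟩,
      ⟨_, mul_mem r₀_mem_edgeGroup r₂_mem_edgeGroup, rfl⟩]
  · rw [eq_top_iff, ← hgen, Subgroup.closure_le]
    rintro _ (rfl | rfl | rfl)
    · exact ⟨_, r₁_mem_mon, by simp [cover_r₁, V, basicFour, Equiv.swap_apply_def]⟩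
    · exact ⟨_, mul_mem r₂_mem_mon (mul_mem r₁_mem_mon r₂_mem_mon), by
        simp [cover_r₁, cover_r₂, V, basicFour, flip₂, Equiv.swap_apply_def]⟩
    · exact ⟨u, hu, u_ff⟩
  · rintro ⟨_ | _, _ | _⟩ hp
    exacts [absurd rfl hp, exists_separating_of_pow hur₁ ur₁_ff ur₁_ft hxz hyz,
      exists_separating_of_pow hur₁ ur₁_ff ur₁_tf hxz hzy,
      exists_separating_of_pow hr₁u r₁u_ff r₁u_tt hzx hyz]

end Realisations

end EdgeTransitiveClass

namespace FlagMap.Voltage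

variable {Φ : Type u} {X : Type v} {G : Type w} [Group G] {M : FlagMap Φ} {N : FlagMap X}

/-- The voltage assignment `V` records how a section `b` of the projection `f` from `M` to its
quotient `N` by the automorphism group `e : G ≃* M.aut` fails to be equivariant. -/
structure Describes (V : N.Voltage G) (f : Φ → X) (e : G ≃* M.aut) (b : X → Φ) : Prop where
  map_section : ∀ x, f (b x) = x
  r₀_section : ∀ x, M.r₀ (b x) = (e (V.c₀ x)).1 (b (N.r₀ x))
  r₁_section : ∀ x, M.r₁ (b x) = (e (V.c₁ x)).1 (b (N.r₁ x))
  r₂_section : ∀ x, M.r₂ (b x) = (e (V.c₂ x)).1 (b (N.r₂ x))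

variable {f : Φ → X} {e : G ≃* M.aut} {b : X → Φ}

theorem aut_one_apply (e : G ≃* M.aut) (y : Φ) : (e 1).1 y = y := by
  rw [map_one]
  rfl

theorem aut_mul_apply (e : G ≃* M.aut) (g h : G) (y : Φ) :
    (e (g * h)).1 y = (e g).1 ((e h).1 y) := by
  rw [map_mul]
  rfl

theorem eq_of_aut_apply_eq (hM : M.Connected) {y : Φ} {g h : G} (hgh : (e g).1 y = (e h).1 y) :
    g = h :=
  e.injective (Subtype.ext (hM.aut_ext (e g).2 (e h).2 hgh))

theorem aut_apply_trans {r s : Equiv.Perm Φ} (hs : s ∈ M.mon) {x y z : Φ} {g h : G}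
    (hx : r x = (e g).1 y) (hy : s y = (e h).1 z) : s (r x) = (e (g * h)).1 z := by
  rw [hx, apply_eq_of_mem_aut (e g).2 hs, hy, aut_mul_apply]

theorem exists_describes (hM : M.Connected) (hf : M.IsAutQuotient N f) (e : G ≃* M.aut)
    (hb : ∀ x, f (b x) = x) : ∃ V : N.Voltage G, V.Describes f e b := by
  have exists_voltage {y y' : Φ} (h : f y = f y') : ∃ g, y = (e g).1 y' := by
    obtain ⟨a, ha, rfl⟩ := (hf.eq_iff y y').mp h
    exact ⟨e.symm ⟨a, ha⟩, by rw [e.apply_symm_apply]⟩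
  choose c₀ h₀ using fun x => exists_voltage
    (show f (M.r₀ (b x)) = f (b (N.r₀ x)) by rw [hf.map_r₀, hb, hb])
  choose c₁ h₁ using fun x => exists_voltage
    (show f (M.r₁ (b x)) = f (b (N.r₁ x)) by rw [hf.map_r₁, hb, hb])
  choose c₂ h₂ using fun x => exists_voltage
    (show f (M.r₂ (b x)) = f (b (N.r₂ x)) by rw [hf.map_r₂, hb, hb])
  have eq_one {x : X} {g : G} (h : b x = (e g).1 (b x)) : g = 1 :=
    eq_of_aut_apply_eq hM (h.symm.trans (aut_one_apply e _).symm)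
  refine ⟨⟨c₀, c₁, c₂, fun x => eq_one (x := x) ?_, fun x => eq_one (x := x) ?_,
    fun x => eq_one (x := x) ?_, fun x => ?_⟩, hb, h₀, h₁, h₂⟩
  · simpa only [r₀_r₀] using aut_apply_trans r₀_mem_mon (h₀ x) (h₀ (N.r₀ x))
  · simpa only [r₁_r₁] using aut_apply_trans r₁_mem_mon (h₁ x) (h₁ (N.r₁ x))
  · simpa only [r₂_r₂] using aut_apply_trans r₂_mem_mon (h₂ x) (h₂ (N.r₂ x))
  · have h₀₂ := aut_apply_trans r₂_mem_mon (h₀ x) (h₂ (N.r₀ x))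
    rw [r₂_r₀, r₂_r₀] at h₀₂
    exact eq_of_aut_apply_eq hM (h₀₂.symm.trans (aut_apply_trans r₀_mem_mon (h₂ x) (h₀ (N.r₂ x))))

namespace Describes

variable {V : N.Voltage G} (hV : V.Describes f e b) (hM : M.Connected)
include hV

theorem r₀_aut_apply (x : X) (g : G) :
    M.r₀ ((e g).1 (b x)) = (e (g * V.c₀ x)).1 (b (N.r₀ x)) := by
  rw [aut_mul_apply, ← hV.r₀_section, apply_eq_of_mem_aut (e g).2 r₀_mem_mon]

theorem r₁_aut_apply (x : X) (g : G) :
    M.r₁ ((e g).1 (b x)) = (e (g * V.c₁ x)).1 (b (N.r₁ x)) := by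
  rw [aut_mul_apply, ← hV.r₁_section, apply_eq_of_mem_aut (e g).2 r₁_mem_mon]

theorem r₂_aut_apply (x : X) (g : G) :
    M.r₂ ((e g).1 (b x)) = (e (g * V.c₂ x)).1 (b (N.r₂ x)) := by
  rw [aut_mul_apply, ← hV.r₂_section, apply_eq_of_mem_aut (e g).2 r₂_mem_mon]

include hM

theorem eq_one_of_r₀_section {x : X} (h : M.r₀ (b x) = b (N.r₀ x)) : V.c₀ x = 1 :=
  eq_of_aut_apply_eq hM ((hV.r₀_section x).symm.trans (h.trans (aut_one_apply e _).symm))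

theorem eq_one_of_r₂_section {x : X} (h : M.r₂ (b x) = b (N.r₂ x)) : V.c₂ x = 1 :=
  eq_of_aut_apply_eq hM ((hV.r₂_section x).symm.trans (h.trans (aut_one_apply e _).symm))

variable (hf : M.IsAutQuotient N f)
include hf

theorem exists_coverEquiv : ∃ E : X × G ≃ Φ, (∀ x g, E (x, g) = (e g).1 (b x)) ∧
    ∀ z, f (E z) = z.1 := by
  have map_apply (x : X) (g : G) : f ((e g).1 (b x)) = x :=
    ((hf.eq_iff _ _).mpr ⟨_, (e g).2, rfl⟩).trans (hV.map_section x)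
  refine ⟨Equiv.ofBijective (fun z => (e z.2).1 (b z.1)) ⟨?_, fun y => ?_⟩, fun _ _ => rfl,
    fun z => map_apply z.1 z.2⟩
  · rintro ⟨x, g⟩ ⟨y, h⟩ hxy
    obtain rfl : x = y := (map_apply x g).symm.trans ((congrArg f hxy).trans (map_apply y h))
    exact congrArg (Prod.mk x) (eq_of_aut_apply_eq hM hxy)
  · obtain ⟨a, ha, hay⟩ := (hf.eq_iff y (b (f y))).mp (hV.map_section _).symm
    exact ⟨(f y, e.symm ⟨a, ha⟩), by simpa using hay⟩

theorem eq_top_of_mem (x₀ : X) {H : Subgroup G} (h₀ : ∀ x, V.c₀ x ∈ H) (h₁ : ∀ x, V.c₁ x ∈ H)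
    (h₂ : ∀ x, V.c₂ x ∈ H) : H = ⊤ := by
  obtain ⟨E, hE, -⟩ := hV.exists_coverEquiv hM hf
  rw [Subgroup.eq_top_iff']
  intro g
  suffices reachable : ∃ x, ∃ h ∈ H, (e h).1 (b x) = (e g).1 (b x₀) by
    obtain ⟨x, h, hh, hx⟩ := reachable
    rw [← hE, ← hE, E.apply_eq_iff_eq, Prod.mk.injEq] at hx
    exact hx.2 ▸ hh
  refine hM.induction (P := fun y => ∃ x, ∃ h ∈ H, (e h).1 (b x) = y) (x₀ := b x₀)
    ⟨x₀, 1, one_mem H, aut_one_apply e _⟩ ?_ ?_ ?_ _ <;> rintro _ ⟨x, h, hh, rfl⟩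
  · exact ⟨_, _, mul_mem hh (h₀ x), (hV.r₀_aut_apply x h).symm⟩
  · exact ⟨_, _, mul_mem hh (h₁ x), (hV.r₁_aut_apply x h).symm⟩
  · exact ⟨_, _, mul_mem hh (h₂ x), (hV.r₂_aut_apply x h).symm⟩

/-- `t` and `α` lift to an automorphism of `M`, which acts trivially on `M / Aut M`. -/
theorem apply_eq_self_of_symmetry (t : Equiv.Perm X) (α : G ≃* G)
    (h₀ : ∀ x, N.r₀ (t x) = t (N.r₀ x) ∧ V.c₀ (t x) = α (V.c₀ x))
    (h₁ : ∀ x, N.r₁ (t x) = t (N.r₁ x) ∧ V.c₁ (t x) = α (V.c₁ x))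
    (h₂ : ∀ x, N.r₂ (t x) = t (N.r₂ x) ∧ V.c₂ (t x) = α (V.c₂ x)) (x : X) : t x = x := by
  obtain ⟨E, hE, map_E⟩ := hV.exists_coverEquiv hM hf
  let a : Equiv.Perm Φ := E.permCongr (Equiv.prodCongr t α.toEquiv)
  have a_apply (x : X) (g : G) : a ((e g).1 (b x)) = (e (α g)).1 (b (t x)) := by
    simp [a, ← hE, Equiv.permCongr_apply]
  have ha : a ∈ M.aut := by
    rw [mem_aut_iff]
    refine ⟨fun y => ?_, fun y => ?_, fun y => ?_⟩ <;> obtain ⟨⟨x, g⟩, rfl⟩ := E.surjective y <;>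
      rw [hE, a_apply]
    · rw [hV.r₀_aut_apply, hV.r₀_aut_apply, a_apply, (h₀ x).1, (h₀ x).2, map_mul α]
    · rw [hV.r₁_aut_apply, hV.r₁_aut_apply, a_apply, (h₁ x).1, (h₁ x).2, map_mul α]
    · rw [hV.r₂_aut_apply, hV.r₂_aut_apply, a_apply, (h₂ x).1, (h₂ x).2, map_mul α]
  have key := (hf.eq_iff (a (E (x, 1))) (E (x, 1))).mpr ⟨a, ha, rfl⟩
  rwa [hE, a_apply, ← hE, ← hE, map_E, map_E] at key

end Describes

end FlagMap.Voltage

namespace EdgeTransitiveClass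

open FlagMap FlagMap.Voltage

section Obstructions

variable {G : Type u} [Group G]

theorem generatedByFlagReflections_of_realisedOver (h : (basicMap one).RealisedOver G) :
    GeneratedByFlagReflections G := by
  obtain ⟨Φ, M, hM, -, ⟨f, hf⟩, ⟨e⟩⟩ := h
  obtain ⟨x₀⟩ := hM.1
  obtain ⟨V, hV⟩ := exists_describes hM hf e (b := fun _ => x₀) fun _ => rfl
  exact ⟨V.c₀ (), V.c₁ (), V.c₂ (), V.c₀_mul (), V.c₁_mul (), V.c₂_mul (), V.comm (),
    hV.eq_top_of_mem hM hf () (fun _ => Subgroup.subset_closure (by simp))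
      (fun _ => Subgroup.subset_closure (by simp)) (fun _ => Subgroup.subset_closure (by simp))⟩

theorem not_realisedOver_basicTwoEx (hG : GeneratingPairsInvertible G) :
    ¬ basicTwoEx.RealisedOver G := by
  rintro ⟨Φ, M, hM, -, ⟨f, hf⟩, ⟨e⟩⟩
  obtain ⟨x₀, hx₀⟩ := hf.surjective false
  obtain ⟨V, hV⟩ := exists_describes hM hf e (b := fun p => cond p (M.r₀ x₀) x₀)
    (by rintro (_ | _) <;> simp [hf.map_r₀, hx₀, basicTwoEx])
  have c₀_eq (p : Bool) : V.c₀ p = 1 :=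
    hV.eq_one_of_r₀_section hM (by cases p <;> simp [basicTwoEx, r₀_r₀])
  have c₁_true : V.c₁ true = (V.c₁ false)⁻¹ := eq_inv_of_mul_eq_one_right (V.c₁_mul false)
  have c₂_true : V.c₂ true = V.c₂ false := by
    simpa [c₀_eq, basicTwoEx] using V.comm false
  have c₂_inv : (V.c₂ false)⁻¹ = V.c₂ false := inv_eq_of_mul_eq_one_left (V.c₂_mul false)
  have hgen : Subgroup.closure {V.c₁ false, V.c₂ false} = ⊤ := by
    have c₁_mem : V.c₁ false ∈ Subgroup.closure {V.c₁ false, V.c₂ false} :=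
      Subgroup.subset_closure (by simp)
    have c₂_mem : V.c₂ false ∈ Subgroup.closure {V.c₁ false, V.c₂ false} :=
      Subgroup.subset_closure (by simp)
    refine hV.eq_top_of_mem hM hf false (fun p => c₀_eq p ▸ one_mem _) ?_ ?_ <;> rintro (_ | _)
    exacts [c₁_mem, c₁_true ▸ inv_mem c₁_mem, c₂_mem, c₂_true ▸ c₂_mem]
  obtain ⟨α, hα₁, hα₂⟩ := hG _ _ hgen
  refine Bool.not_ne_self false
    (hV.apply_eq_self_of_symmetry hM hf Equiv.boolNot α ?_ ?_ ?_ false) <;>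
    rintro (_ | _) <;> simp [basicTwoEx, c₀_eq, c₁_true, c₂_true, hα₁, hα₂, c₂_inv]

theorem not_realisedOver_basicFive (hG : GeneratingPairsInvertible G) :
    ¬ basicFive.RealisedOver G := by
  rintro ⟨Φ, M, hM, -, ⟨f, hf⟩, ⟨e⟩⟩
  obtain ⟨x₀, hx₀⟩ := hf.surjective (false, false)
  obtain ⟨V, hV⟩ := exists_describes hM hf e
    (b := fun p => cond p.1 (cond p.2 (M.r₀ (M.r₂ x₀)) (M.r₀ x₀)) (cond p.2 (M.r₂ x₀) x₀))
    (by rintro ⟨_ | _, _ | _⟩ <;> simp [hf.map_r₀, hf.map_r₂, hx₀, basicFive, flip₁, flip₂])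
  have c₀_eq (p : Bool × Bool) : V.c₀ p = 1 :=
    hV.eq_one_of_r₀_section hM (by
      obtain ⟨_ | _, _ | _⟩ := p <;> simp [basicFive, flip₁, r₀_r₀])
  have c₂_eq (p : Bool × Bool) : V.c₂ p = 1 :=
    hV.eq_one_of_r₂_section hM (by
      obtain ⟨_ | _, _ | _⟩ := p <;> simp [basicFive, flip₂, r₂_r₂, r₂_r₀])
  have c₁_true (i : Bool) : V.c₁ (i, true) = (V.c₁ (i, false))⁻¹ :=
    eq_inv_of_mul_eq_one_right (V.c₁_mul (i, false))
  have hgen : Subgroup.closure {V.c₁ (false, false), V.c₁ (true, false)} = ⊤ := by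
    have c₁_mem (i : Bool) : V.c₁ (i, false) ∈
        Subgroup.closure {V.c₁ (false, false), V.c₁ (true, false)} :=
      Subgroup.subset_closure (by cases i <;> simp)
    refine hV.eq_top_of_mem hM hf (false, false) (fun p => c₀_eq p ▸ one_mem _) ?_
      fun p => c₂_eq p ▸ one_mem _
    rintro ⟨i, _ | _⟩
    exacts [c₁_mem i, c₁_true i ▸ inv_mem (c₁_mem i)]
  obtain ⟨α, hα₀, hα₁⟩ := hG _ _ hgen
  have hα (i : Bool) : α (V.c₁ (i, false)) = (V.c₁ (i, false))⁻¹ := by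
    cases i
    exacts [hα₀, hα₁]
  have flip₂_fixes := hV.apply_eq_self_of_symmetry hM hf flip₂ α
    (by rintro ⟨_ | _, _ | _⟩ <;> simp [basicFive, flip₁, flip₂, c₀_eq])
    (by rintro ⟨i, _ | _⟩ <;> simp [basicFive, flip₂, c₁_true, hα])
    (by rintro ⟨_ | _, _ | _⟩ <;> simp [basicFive, flip₂, c₂_eq]) (false, false)
  exact absurd flip₂_fixes (by decide)

theorem realises_iff_of_generation [Small.{0} G] (hG : GeneratedByAsymmetricInvolutions G)
    (hinv : GeneratingPairsInvertible G) (T : EdgeTransitiveClass) :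
    T.Realises G ↔ (T = one ∧ GeneratedByFlagReflections G) ∨ (∃ σ, T = two σ) ∨ T = three ∨
      ∃ σ, T = four σ := by
  have hS : GeneratedByAsymmetricInvolutions (Shrink.{0} G) := hG.of_mulEquiv Shrink.mulEquiv.symm
  cases T with
  | one =>
    have realised_iff : (basicMap one).RealisedOver G ↔ GeneratedByFlagReflections G :=
      ⟨generatedByFlagReflections_of_realisedOver, fun h =>
        (realisedOver_basicMap_one (h.of_mulEquiv Shrink.mulEquiv.symm)).of_mulEquiv
          Shrink.mulEquiv.symm⟩
    simpa [realises_iff] using realised_iff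
  | two σ =>
    simpa [realises_iff, basicMap, realisedOver_op_iff] using
      (realisedOver_basicTwo hS).of_mulEquiv Shrink.mulEquiv.symm
  | twoEx σ =>
    simpa [realises_iff, basicMap, realisedOver_op_iff] using not_realisedOver_basicTwoEx hinv
  | three =>
    simpa [realises_iff, basicMap] using
      (realisedOver_basicThree hS).of_mulEquiv Shrink.mulEquiv.symm
  | four σ =>
    simpa [realises_iff, basicMap, realisedOver_op_iff] using
      (realisedOver_basicFour hS).of_mulEquiv Shrink.mulEquiv.symm
  | five σ =>
    simpa [realises_iff, basicMap, realisedOver_op_iff] using not_realisedOver_basicFive hinv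

end Obstructions

end EdgeTransitiveClass

section Involutions

open Subgroup

variable {G : Type u} [Group G]

theorem mem_normalizer_zpowers_of_conj_eq_inv {g w : G} (h : g * w * g⁻¹ = w⁻¹) :
    g ∈ normalizer (zpowers w : Set G) := by
  rw [mem_normalizer_iff_map_conj_eq, MonoidHom.map_zpowers]
  exact (congrArg zpowers h).trans zpowers_inv

theorem normal_zpowers_mul_of_closure_involutions {x y : G} (hx : x * x = 1) (hy : y * y = 1)
    (h : closure {x, y} = ⊤) : (zpowers (x * y)).Normal := by
  have x_inv : x⁻¹ = x := inv_eq_of_mul_eq_one_left hx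
  have y_inv : y⁻¹ = y := inv_eq_of_mul_eq_one_left hy
  rw [← normalizer_eq_top_iff, eq_top_iff, ← h, closure_le]
  rintro g (rfl | rfl) <;> refine mem_normalizer_zpowers_of_conj_eq_inv ?_
  · rw [mul_inv_rev, x_inv, y_inv, ← mul_assoc, hx, one_mul]
  · rw [mul_inv_rev, x_inv, y_inv, mul_assoc, mul_assoc, hy, mul_one]

theorem isMulCommutative_of_closure_involutions [IsSimpleGroup G] {x y : G} (hx : x * x = 1)
    (hy : y * y = 1) (h : closure {x, y} = ⊤) : IsMulCommutative G := by
  suffices cyclic : IsCyclic G from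
    IsCyclic.isMulCommutative
  rcases (normal_zpowers_mul_of_closure_involutions hx hy h).eq_bot_or_eq_top with hbot | htop
  · have y_eq : y = x := by
      rw [zpowers_eq_bot] at hbot
      rw [← inv_eq_of_mul_eq_one_right hbot, inv_eq_of_mul_eq_one_left hx]
    rw [y_eq, Set.pair_eq_singleton, ← zpowers_eq_closure] at h
    exact isCyclic_iff_exists_zpowers_eq_top.mpr ⟨x, h⟩
  · exact isCyclic_iff_exists_zpowers_eq_top.mpr ⟨x * y, htop⟩

theorem eq_one_of_commute_generators [IsSimpleGroup G] (hG : ¬ IsMulCommutative G) {s : Set G}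
    (hs : closure s = ⊤) {z : G} (hz : ∀ g ∈ s, g * z = z * g) : z = 1 := by
  have central : z ∈ center G := by
    have hle : closure s ≤ centralizer {z} :=
      (closure_le _).mpr fun g hg => mem_centralizer_singleton_iff.mpr (hz g hg)
    exact mem_center_iff.mpr fun g => mem_centralizer_singleton_iff.mp (hle (hs ▸ mem_top g))
  rcases (inferInstance : (center G).Normal).eq_bot_or_eq_top with hbot | htop
  · exact mem_bot.mp (hbot ▸ central)
  · exact absurd (isMulCommutative_iff.mpr fun a b => (mem_center_iff.mp (htop ▸ mem_top b) a)) hG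

theorem exists_not_commute_conj [IsSimpleGroup G] (hG : ¬ IsMulCommutative G) {z : G}
    (hz : z ≠ 1) : ∃ g : G, ¬ Commute (g * z * g⁻¹) z := by
  by_contra! hcomm
  refine hz (eq_one_of_commute_generators hG (s := Group.conjugatesOfSet {z}) ?_ ?_)
  · refine (inferInstance : (normalClosure {z}).Normal).eq_bot_or_eq_top.resolve_left fun hbot => ?_
    exact hz (normalClosure_eq_bot_iff.mp hbot rfl)
  · intro g hg
    obtain ⟨_, rfl, hconj⟩ := Group.mem_conjugatesOfSet_iff.mp hg
    obtain ⟨k, rfl⟩ := isConj_iff.mp hconj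
    exact hcomm k

theorem GeneratedByFlagReflections.exists_ne_one [IsSimpleGroup G] (hG : ¬ IsMulCommutative G)
    (h : GeneratedByFlagReflections G) :
    ∃ a b c : G, a * a = 1 ∧ b * b = 1 ∧ c * c = 1 ∧ a * c = c * a ∧ closure {a, b, c} = ⊤ ∧
      a ≠ 1 ∧ b ≠ 1 ∧ c ≠ 1 ∧ a * c ≠ 1 := by
  obtain ⟨a, b, c, ha, hb, hc, hac, hgen⟩ := h
  refine ⟨a, b, c, ha, hb, hc, hac, hgen, ?_, ?_, ?_, fun hac_one => ?_⟩
  · rintro rfl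
    rw [closure_insert_one] at hgen
    exact hG (isMulCommutative_of_closure_involutions hb hc hgen)
  · rintro rfl
    rw [Set.insert_comm, closure_insert_one] at hgen
    exact hG (isMulCommutative_of_closure_involutions ha hc hgen)
  · rintro rfl
    rw [Set.pair_comm, Set.insert_comm, closure_insert_one] at hgen
    exact hG (isMulCommutative_of_closure_involutions ha hb hgen)
  · have c_eq : c = a := by
      rw [← inv_eq_of_mul_eq_one_right hac_one, inv_eq_of_mul_eq_one_left ha]
    rw [c_eq, Set.pair_comm, Set.insert_eq_of_mem (Set.mem_insert a {b})] at hgen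
    exact hG (isMulCommutative_of_closure_involutions ha hb hgen)

theorem GeneratedByFlagReflections.asymmetric [IsSimpleGroup G] (hG : ¬ IsMulCommutative G)
    (h : GeneratedByFlagReflections G) : GeneratedByAsymmetricInvolutions G := by
  obtain ⟨a, b, c, ha, hb, hc, hac, hgen, a_ne, b_ne, c_ne, -⟩ := h.exists_ne_one hG
  have hgen' : closure {c, b, a} = ⊤ := by
    rw [Set.pair_comm b a, Set.insert_comm, Set.pair_comm c b, hgen]
  refine ⟨c, b, a, hc, hb, ha, c_ne, b_ne, a_ne, hgen', 2, ?_, fun hab => a_ne ?_⟩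
  · rw [Commute.mul_pow hac, sq, sq, ha, hc, mul_one]
  · have hba : b * a = a * b := by
      rw [sq, mul_eq_one_iff_eq_inv, mul_inv_rev, inv_eq_of_mul_eq_one_left ha,
        inv_eq_of_mul_eq_one_left hb] at hab
      exact hab.symm
    refine eq_one_of_commute_generators hG hgen ?_
    rintro g (rfl | rfl | rfl)
    exacts [rfl, hba, hac.symm]

end Involutions

section FiniteField

variable (F : Type u) [Field F] [Finite F]

theorem exists_unit_orderOf_eq : ∃ ν : Fˣ, orderOf ν = Nat.card F - 1 := by
  obtain ⟨ν, hν⟩ := IsCyclic.exists_ofOrder_eq_natCard (α := Fˣ)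
  exact ⟨ν, hν.trans (Nat.card_units F)⟩

variable {F}

theorem exists_eq_mul_self_add_mul_self (x : F) : ∃ r s : F, x = r * r + s * s := by
  have := Fintype.ofFinite F
  by_cases char_two : ringChar F = 2
  · obtain ⟨r, hr⟩ := FiniteField.isSquare_of_char_two char_two x
    exact ⟨r, 0, by rw [hr]; ring⟩
  · obtain ⟨r, s, hrs⟩ := FiniteField.exists_root_sum_quadratic (R := F)
      (f := Polynomial.X ^ 2) (g := Polynomial.X ^ 2 - Polynomial.C x)
      (Polynomial.degree_X_pow 2) (Polynomial.degree_X_pow_sub_C two_pos _)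
      (FiniteField.odd_card_of_char_ne_two char_two)
    simp only [Polynomial.eval_pow, Polynomial.eval_X, Polynomial.eval_sub,
      Polynomial.eval_C] at hrs
    exact ⟨r, s, by linear_combination -hrs⟩

omit [Finite F] in
theorem exists_eq_mul_self_mul {x y : F} (hx : x ≠ 0) (hy : y ≠ 0) (h : IsSquare (x * y)) :
    ∃ n ≠ 0, x = n * n * y := by
  obtain ⟨s, hs⟩ := h
  have s_ne : s ≠ 0 := by
    rintro rfl
    exact mul_ne_zero hx hy (hs.trans (mul_zero 0))
  refine ⟨s / y, div_ne_zero s_ne hy, ?_⟩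
  field_simp
  linear_combination hs

theorem exists_ne_isSquare_mul {ι : Type*} {s : Finset ι} {f : ι → F} (hf : ∀ i ∈ s, f i ≠ 0)
    (hs : 2 < s.card ∨ ringChar F = 2 ∧ 1 < s.card) :
    ∃ i ∈ s, ∃ j ∈ s, i ≠ j ∧ IsSquare (f i * f j) := by
  classical
  have := Fintype.ofFinite F
  rcases hs with two_lt | ⟨char_two, one_lt⟩
  · obtain ⟨i, hi, j, hj, hij, heq⟩ := Finset.exists_ne_map_eq_of_card_lt_of_maps_to
      (f := fun i => quadraticChar F (f i)) (t := {1, -1})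
      (Finset.card_le_two.trans_lt two_lt) fun i hi => by
        simpa using quadraticChar_dichotomy (hf i hi)
    refine ⟨i, hi, j, hj, hij, (quadraticChar_one_iff_isSquare ?_).mp ?_⟩
    · exact mul_ne_zero (hf i hi) (hf j hj)
    · rw [map_mul, ← heq, ← sq, quadraticChar_sq_one (hf i hi)]
  · obtain ⟨i, hi, j, hj, hij⟩ := Finset.one_lt_card.mp one_lt
    exact ⟨i, hi, j, hj, hij, FiniteField.isSquare_of_char_two char_two _⟩

omit [Finite F] in
/-- If `-1 = i²` then `(i(1 - ν²)/(1 + ν²), 2iν/(1 + ν²))` is on the circle `r² + s² = -1`, for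
every `ν`. -/
theorem exists_mul_self_add_mul_self_eq_neg_one_of_isSquare (h2 : (2 : F) ≠ 0) {ν : F} (hν : ν ≠ 0)
    (hν₂ : ν ^ 2 ≠ 1) (hν₄ : ν ^ 4 ≠ 1) {i : F} (hi : i * i = -1) :
    ∃ r s : F, r ≠ 0 ∧ s ≠ 0 ∧ r * r + s * s = -1 := by
  have i_ne : i ≠ 0 := by rintro rfl; simp at hi
  have hadd : 1 + ν ^ 2 ≠ 0 := fun h => hν₄ (by linear_combination (ν ^ 2 - 1) * h)
  have hsub : 1 - ν ^ 2 ≠ 0 := fun h => hν₂ (by linear_combination -h)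
  refine ⟨i * (1 - ν ^ 2) / (1 + ν ^ 2), i * (2 * ν) / (1 + ν ^ 2),
    div_ne_zero (mul_ne_zero i_ne hsub) hadd,
    div_ne_zero (mul_ne_zero i_ne (mul_ne_zero h2 hν)) hadd, ?_⟩
  field_simp
  linear_combination ((1 - ν ^ 2) ^ 2 + 4 * ν ^ 2) * hi

theorem exists_mul_self_add_mul_self_eq_neg_one (hF : 5 < Nat.card F) :
    ∃ r s : F, r ≠ 0 ∧ s ≠ 0 ∧ r * r + s * s = -1 := by
  obtain ⟨ν, hν⟩ := exists_unit_orderOf_eq F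
  have pow_ne : ∀ m ≠ 0, m ≤ 4 → (ν : F) ^ m ≠ 1 := fun m hm hm' h =>
    pow_ne_one_of_lt_orderOf hm (by omega) (Units.ext (by simpa using h) : ν ^ m = 1)
  by_cases h2 : (2 : F) = 0
  · refine ⟨ν, 1 + ν, ν.ne_zero, fun h => pow_ne 1 one_ne_zero (by omega) ?_, ?_⟩
    · linear_combination h - h2
    · linear_combination ((ν : F) * ν + ν + 1) * h2
  obtain ⟨r, s, hrs⟩ := exists_eq_mul_self_add_mul_self (-1 : F)
  have square := fun i => exists_mul_self_add_mul_self_eq_neg_one_of_isSquare h2 ν.ne_zero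
    (pow_ne 2 two_ne_zero (by omega)) (pow_ne 4 four_ne_zero le_rfl) (i := i)
  by_cases hr : r = 0
  · exact square s (by rw [hrs, hr]; ring)
  by_cases hs : s = 0
  · exact square r (by rw [hrs, hs]; ring)
  exact ⟨r, s, hr, hs, hrs.symm⟩

end FiniteField

namespace SL2

open Matrix

section CommRing

variable {R : Type u} [CommRing R]

/-- The matrix with rows `(a, b)` and `(c, d)` has determinant one and lies in `H`.  Stating
membership for entries lets products be normalised by `ring`. -/
def Mem (H : Subgroup (SpecialLinearGroup (Fin 2) R)) (a b c d : R) : Prop :=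
  ∃ M ∈ H, (M : Matrix (Fin 2) (Fin 2) R) = !![a, b; c, d]

variable {H : Subgroup (SpecialLinearGroup (Fin 2) R)} {a b c d a' b' c' d' : R}

theorem Mem.det (h : Mem H a b c d) : a * d - b * c = 1 := by
  obtain ⟨M, -, hM⟩ := h
  have det_one := M.det_coe
  rwa [hM, det_fin_two_of] at det_one

theorem Mem.mul (h : Mem H a b c d) (h' : Mem H a' b' c' d') :
    Mem H (a * a' + b * c') (a * b' + b * d') (c * a' + d * c') (c * b' + d * d') := by
  obtain ⟨M, hM, e⟩ := h
  obtain ⟨M', hM', e'⟩ := h'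
  refine ⟨M * M', mul_mem hM hM', (Matrix.SpecialLinearGroup.coe_mul M M').trans ?_⟩
  rw [e, e', mul_fin_two]

theorem Mem.inv (h : Mem H a b c d) : Mem H d (-b) (-c) a := by
  obtain ⟨M, hM, e⟩ := h
  refine ⟨M⁻¹, inv_mem hM, (Matrix.SpecialLinearGroup.coe_inv M).trans ?_⟩
  rw [e, adjugate_fin_two_of]

theorem Mem.congr (h : Mem H a b c d) (ha : a = a') (hb : b = b') (hc : c = c') (hd : d = d') :
    Mem H a' b' c' d' :=
  ha ▸ hb ▸ hc ▸ hd ▸ h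

theorem Mem.one : Mem H 1 0 0 1 := ⟨1, one_mem H, one_fin_two⟩

theorem eq_top_iff_mem : H = ⊤ ↔ ∀ a b c d : R, a * d - b * c = 1 → Mem H a b c d := by
  constructor
  · rintro rfl a b c d h
    exact ⟨⟨!![a, b; c, d], by rw [det_fin_two_of, h]⟩, Subgroup.mem_top _, rfl⟩
  · intro h
    refine (Subgroup.eq_top_iff' H).mpr fun M => ?_
    obtain ⟨N, hN, e⟩ := h (M 0 0) (M 0 1) (M 1 0) (M 1 1)
      ((det_fin_two _).symm.trans M.det_coe)
    exact (Subtype.ext (e.trans (eta_fin_two _).symm) : N = M) ▸ hN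

/-- The additive group of all `t` for which the unipotent matrix with rows `(1, t)` and `(0, 1)`
lies in `H`. -/
def unipotents (H : Subgroup (SpecialLinearGroup (Fin 2) R)) : AddSubgroup R where
  carrier := {t | Mem H 1 t 0 1}
  zero_mem' := Mem.one
  add_mem' := fun hs ht => (hs.mul ht).congr (by ring) (by ring) (by ring) (by ring)
  neg_mem' := fun h => h.inv.congr rfl rfl neg_zero rfl

theorem mem_unipotents {t : R} : t ∈ unipotents H ↔ Mem H 1 t 0 1 := Iff.rfl

theorem Mem.two_mul_mem_unipotents {p t : R} (hp : p * p = 1) (h : Mem H p t 0 p) :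
    2 * (p * t) ∈ unipotents H :=
  (h.mul h).congr (by rw [hp]; ring) (by ring) (by ring) (by rw [hp]; ring)

end CommRing

section Generation

variable {F : Type u} [Field F] {H : Subgroup (SpecialLinearGroup (Fin 2) F)} {a b c d : F}

theorem Mem.lower_unipotent (hu : unipotents H = ⊤) (h : Mem H a b c d) (hc : c ≠ 0) (t : F) :
    Mem H 1 0 t 1 := by
  have upper : ∀ t : F, Mem H 1 t 0 1 := fun t => mem_unipotents.mp (hu ▸ AddSubgroup.mem_top t)
  have weyl : Mem H 0 (-c⁻¹) c 0 := by
    have hdet := h.det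
    refine (((upper (-(a / c))).mul h).mul (upper (-(d / c)))).congr ?_ ?_ ?_ ?_
    · field_simp; ring
    · field_simp
      linear_combination -hdet
    · ring
    · field_simp; ring
  exact ((weyl.mul (upper (-(t / (c * c))))).mul weyl.inv).congr (by field_simp; ring) (by ring)
    (by field_simp; ring) (by field_simp; ring)

theorem eq_top_of_unipotents (hu : unipotents H = ⊤) (h : Mem H a b c d) (hc : c ≠ 0) :
    H = ⊤ := by
  have upper : ∀ t : F, Mem H 1 t 0 1 := fun t => mem_unipotents.mp (hu ▸ AddSubgroup.mem_top t)
  have lower := h.lower_unipotent hu hc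
  have big_cell : ∀ a b c d : F, a * d - b * c = 1 → c ≠ 0 → Mem H a b c d := by
    intro a b c d hdet hc
    refine (((upper ((a - 1) / c)).mul (lower c)).mul (upper ((d - 1) / c))).congr ?_ ?_ ?_ ?_
    · field_simp; ring
    · field_simp
      linear_combination hdet
    · ring
    · field_simp; ring
  refine eq_top_iff_mem.mpr fun a b c d hdet => ?_
  by_cases hc : c = 0
  · subst hc
    have ha : a ≠ 0 := by rintro rfl; simp at hdet
    exact ((lower (-1)).mul (big_cell a b a (b + d) (by linear_combination hdet) ha)).congr
      (by ring) (by ring) (by ring) (by ring)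
  · exact big_cell a b c d hdet hc

section Torus

variable (hD : ∀ l : F, l ≠ 0 → Mem H l 0 0 l⁻¹)
include hD

/-- The lower rows agree up to right multiplication by `diag(m, m⁻¹)`, so the quotient is upper
triangular. -/
theorem exists_upper_of_rows {a' b' c' d' m : F} (h : Mem H a b c d) (h' : Mem H a' b' c' d')
    (hm : m ≠ 0) (hr : c * d' = m * m * c' * d) (hne : a * d ≠ a' * d') :
    ∃ p t q : F, t ≠ 0 ∧ Mem H p t 0 q := by
  refine ⟨_, _, _, ?_, (h.mul (h'.mul (hD m hm)).inv).congr rfl rfl ?_ rfl⟩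
  · intro h0
    have upper_rows : b * a' * (m * m) = a * b' := by
      field_simp at h0
      linear_combination h0
    have cross : (b * c) * (a' * d') = (a * d) * (b' * c') := by
      refine mul_left_cancel₀ (mul_ne_zero hm hm) ?_
      linear_combination c * d' * upper_rows + a * b' * hr
    exact hne (by linear_combination cross + (a' * d') * h.det - (a * d) * h'.det)
  · field_simp
    linear_combination hr

theorem unipotents_eq_top_of_upper [Finite F] {p t q : F} (ht : t ≠ 0) (h : Mem H p t 0 q) :
    unipotents H = ⊤ := by
  have hdet := h.det
  have hp : p ≠ 0 := by rintro rfl; simp at hdet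
  have hq : q = p⁻¹ := by field_simp; linear_combination hdet
  have unipotent : Mem H 1 (t * p) 0 1 := by
    refine (h.mul (hD p⁻¹ (inv_ne_zero hp))).congr ?_ ?_ ?_ ?_
    · field_simp; ring
    · field_simp; ring
    · ring
    · rw [hq]; field_simp; ring
  have square_mul : ∀ l : F, t * p * (l * l) ∈ unipotents H := by
    intro l
    by_cases hl : l = 0
    · rw [hl, mul_zero, mul_zero]
      exact zero_mem _
    · refine (((hD l hl).mul unipotent).mul (hD l⁻¹ (inv_ne_zero hl))).congr ?_ ?_ ?_ ?_
      · field_simp; ring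
      · field_simp; ring
      · ring
      · field_simp; ring
  refine (AddSubgroup.eq_top_iff' _).mpr fun x => ?_
  obtain ⟨l, m, hlm⟩ := exists_eq_mul_self_add_mul_self (x / (t * p))
  rw [(mul_div_cancel₀ x (mul_ne_zero ht hp)).symm, hlm, mul_add]
  exact add_mem (square_mul l) (square_mul m)

/-- Compares the conjugates of `diag(l, l⁻¹)` and `diag(m, m⁻¹)` by the given matrix.  Up to
squares, the ratio of the entries in the lower row of the first is `(l² - 1)(ad - bcl²)`. -/
theorem eq_top_of_torus_pair [Finite F] (h : Mem H a b c d) (ha : a ≠ 0) (hb : b ≠ 0) (hc : c ≠ 0)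
    (hd : d ≠ 0) {l m : F} (hl : l ≠ 0) (hm : m ≠ 0) (hlm : l * l ≠ m * m)
    (hlm' : (l * l) * (m * m) ≠ 1) (hl₀ : (l * l - 1) * (a * d - b * c * (l * l)) ≠ 0)
    (hm₀ : (m * m - 1) * (a * d - b * c * (m * m)) ≠ 0)
    (hsq : IsSquare ((l * l - 1) * (a * d - b * c * (l * l)) *
      ((m * m - 1) * (a * d - b * c * (m * m))))) : H = ⊤ := by
  obtain ⟨n, hn, hratio⟩ := exists_eq_mul_self_mul
    (mul_ne_zero (left_ne_zero_of_mul hl₀) (right_ne_zero_of_mul hm₀))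
    (mul_ne_zero (left_ne_zero_of_mul hm₀) (right_ne_zero_of_mul hl₀))
    ((congrArg IsSquare (by ring)).mp hsq)
  have conj : ∀ l : F, l ≠ 0 → Mem H (a * d * l - b * c * l⁻¹) (a * b * (l⁻¹ - l))
      (c * d * (l - l⁻¹)) (a * d * l⁻¹ - b * c * l) := fun l hl =>
    ((h.mul (hD l hl)).mul h.inv).congr (by ring) (by ring) (by ring) (by ring)
  obtain ⟨p, t, q, ht, hu⟩ := exists_upper_of_rows hD (conj l hl) (conj m hm) hn (by
      field_simp
      linear_combination hratio) (by
      intro heq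
      have hprod : (a * d * (b * c)) * ((l * l - m * m) * (l * l * (m * m) - 1)) = 0 := by
        field_simp at heq
        linear_combination -heq
      exact mul_ne_zero (mul_ne_zero (mul_ne_zero ha hd) (mul_ne_zero hb hc))
        (mul_ne_zero (sub_ne_zero.mpr hlm) (sub_ne_zero.mpr hlm')) hprod)
  exact eq_top_of_unipotents (unipotents_eq_top_of_upper hD ht hu) h hc

/-- Among `ν, …, νⁿ` at most one is a pole of the ratio in `eq_top_of_torus_pair`, and there are at
most two square classes. -/
theorem eq_top_of_torus_of_unit [Finite F] {ν : Fˣ} {n : ℕ} (hν : 2 * n ≤ orderOf (ν * ν))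
    (hn : 3 < n ∨ ringChar F = 2 ∧ 2 < n) (h : Mem H a b c d) (ha : a ≠ 0) (hb : b ≠ 0)
    (hc : c ≠ 0) (hd : d ≠ 0) : H = ⊤ := by
  classical
  have sq_pow : ∀ i, (↑(ν ^ i) : F) * ↑(ν ^ i) = ↑((ν * ν) ^ i) := fun i => by
    rw [mul_pow, Units.val_mul]
  have inj : ∀ i ∈ Finset.Icc 1 n, ∀ j ∈ Finset.Icc 1 n, (ν * ν) ^ i = (ν * ν) ^ j → i = j := by
    intro i hi j hj
    rw [Finset.mem_Icc] at hi hj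
    exact pow_injOn_Iio_orderOf (Set.mem_Iio.mpr (by omega)) (Set.mem_Iio.mpr (by omega))
  have pow_ne : ∀ k, k ≠ 0 → k < 2 * n → (ν * ν) ^ k ≠ 1 := fun k hk hk' =>
    pow_ne_one_of_lt_orderOf hk (hk'.trans_le hν)
  let ratio : ℕ → F := fun i =>
    (↑(ν ^ i) * ↑(ν ^ i) - 1) * (a * d - b * c * (↑(ν ^ i) * ↑(ν ^ i)))
  have zeros : ((Finset.Icc 1 n).filter fun i => ratio i = 0).card ≤ 1 := by
    refine Finset.card_le_one.mpr fun i hi j hj => ?_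
    rw [Finset.mem_filter] at hi hj
    have pole : ∀ k ∈ Finset.Icc 1 n, ratio k = 0 → a * d = b * c * ↑((ν * ν) ^ k) := by
      intro k hk hk₀
      simp only [ratio, sq_pow] at hk₀
      rw [Finset.mem_Icc] at hk
      refine sub_eq_zero.mp ((mul_eq_zero.mp hk₀).resolve_left (sub_ne_zero.mpr ?_))
      exact fun h => pow_ne k (by omega) (by omega) (Units.ext h)
    refine inj i hi.1 j hj.1 (Units.ext (mul_left_cancel₀ (mul_ne_zero hb hc) ?_))
    rw [← pole i hi.1 hi.2, pole j hj.1 hj.2]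
  have split := Finset.card_filter_add_card_filter_not (s := Finset.Icc 1 n) fun i => ratio i = 0
  rw [Nat.card_Icc] at split
  obtain ⟨i, hi, j, hj, hij, square⟩ := exists_ne_isSquare_mul
    (s := (Finset.Icc 1 n).filter fun i => ratio i ≠ 0) (f := ratio)
    (fun i hi => (Finset.mem_filter.mp hi).2) (by simp only [ne_eq]; omega)
  rw [Finset.mem_filter] at hi hj
  refine eq_top_of_torus_pair hD h ha hb hc hd (ν ^ i).ne_zero (ν ^ j).ne_zero ?_ ?_ hi.2 hj.2
    square
  · rw [sq_pow, sq_pow]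
    exact fun heq => hij (inj i hi.1 j hj.1 (Units.ext heq))
  · rw [sq_pow, sq_pow, ← Units.val_mul, ← pow_add]
    rw [Finset.mem_Icc] at hi hj
    exact fun heq => pow_ne (i + j) (by omega) (by omega) (Units.ext heq)

theorem eq_top_of_torus [Finite F] (hF : 15 < Nat.card F ∨ ringChar F = 2 ∧ Nat.card F = 8)
    (h : Mem H a b c d) (ha : a ≠ 0) (hb : b ≠ 0) (hc : c ≠ 0) (hd : d ≠ 0) : H = ⊤ := by
  obtain ⟨ν, hν⟩ := exists_unit_orderOf_eq F
  rcases hF with hF | ⟨char_two, hF⟩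
  · have order_le : orderOf ν ≤ 2 * orderOf (ν * ν) :=
      orderOf_le_of_pow_eq_one (mul_pos two_pos (orderOf_pos _))
        (by rw [pow_mul, sq, pow_orderOf_eq_one])
    exact eq_top_of_torus_of_unit hD (ν := ν) (n := 4) (by omega) (Or.inl (by omega)) h ha hb hc hd
  · have order : 2 * 3 ≤ orderOf (ν * ν) := by
      rw [← sq, orderOf_pow, hν, hF]
      decide
    exact eq_top_of_torus_of_unit hD order (Or.inr ⟨char_two, by omega⟩) h ha hb hc hd

end Torus

end Generation

section Projection

variable {F : Type u} [Field F]

/-- The projection from `SL₂(F)` to `PSL₂(F)`. -/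
abbrev proj (F : Type u) [Field F] :
    SpecialLinearGroup (Fin 2) F →* ProjectiveSpecialLinearGroup (Fin 2) F :=
  QuotientGroup.mk' (Subgroup.center (SpecialLinearGroup (Fin 2) F))

theorem proj_surjective : Function.Surjective (proj F) := QuotientGroup.mk'_surjective _

theorem det_entry (M : SpecialLinearGroup (Fin 2) F) : M 0 0 * M 1 1 - M 0 1 * M 1 0 = 1 :=
  (det_fin_two _).symm.trans M.det_coe

theorem mem_center_iff_entries {M : SpecialLinearGroup (Fin 2) F} :
    M ∈ Subgroup.center (SpecialLinearGroup (Fin 2) F) ↔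
      M 0 1 = 0 ∧ M 1 0 = 0 ∧ M 0 0 = M 1 1 := by
  rw [Matrix.SpecialLinearGroup.mem_center_iff]
  constructor
  · rintro ⟨r, -, hr⟩
    simp [← hr]
  · rintro ⟨h₀₁, h₁₀, heq⟩
    refine ⟨M 0 0, ?_, ?_⟩
    · rw [Fintype.card_fin]
      linear_combination det_entry M + M 0 0 * heq + M 0 1 * h₁₀
    · ext i j
      fin_cases i <;> fin_cases j <;> simp [h₀₁, h₁₀, heq]

theorem proj_eq_one_iff {M : SpecialLinearGroup (Fin 2) F} :
    proj F M = 1 ↔ M 0 1 = 0 ∧ M 1 0 = 0 ∧ M 0 0 = M 1 1 :=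
  (QuotientGroup.eq_one_iff M).trans mem_center_iff_entries

theorem mul_entry (M N : SpecialLinearGroup (Fin 2) F) (i j : Fin 2) :
    (M * N) i j = M i 0 * N 0 j + M i 1 * N 1 j := by
  rw [Matrix.SpecialLinearGroup.coe_mul, Matrix.mul_apply, Fin.sum_univ_two]

theorem proj_mul_self {M : SpecialLinearGroup (Fin 2) F} (h : M.1.trace = 0) :
    proj F M * proj F M = 1 := by
  rw [trace_fin_two] at h
  rw [← map_mul, proj_eq_one_iff]
  simp only [mul_entry]
  refine ⟨?_, ?_, ?_⟩
  · linear_combination M 0 1 * h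
  · linear_combination M 1 0 * h
  · linear_combination (M 0 0 - M 1 1) * h

theorem proj_comm {M N : SpecialLinearGroup (Fin 2) F} (hM : M.1.trace = 0)
    (hN : N.1.trace = 0) (hMN : (M * N).1.trace = 0) : Commute (proj F M) (proj F N) := by
  have hmul := proj_mul_self hMN
  rw [map_mul] at hmul
  rw [commute_iff_eq, ← inv_eq_of_mul_eq_one_left hmul, _root_.mul_inv_rev,
    inv_eq_of_mul_eq_one_left (proj_mul_self hM), inv_eq_of_mul_eq_one_left (proj_mul_self hN)]

theorem proj_ne_one_of_trace {M : SpecialLinearGroup (Fin 2) F} (h : M.1.trace ^ 2 ≠ 4) :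
    proj F M ≠ 1 := by
  rw [Ne, proj_eq_one_iff]
  rintro ⟨h₀₁, -, heq⟩
  refine h ?_
  rw [trace_fin_two]
  linear_combination 4 * det_entry M + (M 0 0 - M 1 1) * heq + 4 * M 1 0 * h₀₁

theorem proj_pow_three_eq_one_iff {M : SpecialLinearGroup (Fin 2) F} :
    proj F M ^ 3 = 1 ↔ proj F M = 1 ∨ M.1.trace ^ 2 = 1 := by
  have h := det_entry M
  have h₀₁ : (M ^ 3) 0 1 = M 0 1 * (M.1.trace ^ 2 - 1) := by
    simp only [pow_succ M, pow_zero, one_mul, mul_entry, trace_fin_two]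
    linear_combination -M 0 1 * h
  have h₁₀ : (M ^ 3) 1 0 = M 1 0 * (M.1.trace ^ 2 - 1) := by
    simp only [pow_succ M, pow_zero, one_mul, mul_entry, trace_fin_two]
    linear_combination -M 1 0 * h
  have hdiag : (M ^ 3) 0 0 - (M ^ 3) 1 1 = (M 0 0 - M 1 1) * (M.1.trace ^ 2 - 1) := by
    simp only [pow_succ M, pow_zero, one_mul, mul_entry, trace_fin_two]
    linear_combination (M 1 1 - M 0 0) * h
  rw [← map_pow, proj_eq_one_iff, proj_eq_one_iff, h₀₁, h₁₀, ← sub_eq_zero (b := (M ^ 3) 1 1),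
    hdiag, mul_eq_zero, mul_eq_zero, mul_eq_zero, sub_eq_zero, sub_eq_zero]
  tauto

/-- The element of `SL₂(F)` with rows `(a, b)` and `(c, d)`. -/
def mk (a b c d : F) (h : a * d - b * c = 1) : SpecialLinearGroup (Fin 2) F :=
  ⟨!![a, b; c, d], by rw [det_fin_two_of, h]⟩

theorem trace_mk_mul_mk {a b c d a' b' c' d' : F} (h : a * d - b * c = 1)
    (h' : a' * d' - b' * c' = 1) :
    (mk a b c d h * mk a' b' c' d' h').1.trace = a * a' + b * c' + c * b' + d * d' := by
  rw [Matrix.SpecialLinearGroup.coe_mul]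
  simp only [mk, mul_fin_two, trace_fin_two_of]
  ring

theorem trace_mk {a b c d : F} (h : a * d - b * c = 1) : (mk a b c d h).1.trace = a + d :=
  trace_fin_two_of a b c d

theorem not_isMulCommutative_psl :
    ¬ IsMulCommutative (ProjectiveSpecialLinearGroup (Fin 2) F) := by
  rw [isMulCommutative_iff]
  intro h
  have hcomm := h (proj F (mk 1 1 0 1 (by ring))) (proj F (mk 1 0 1 1 (by ring)))
  rw [← map_mul, ← map_mul, ← inv_mul_eq_one, ← map_inv, ← map_mul, proj_eq_one_iff] at hcomm
  simp only [mul_entry, Matrix.SpecialLinearGroup.coe_inv, adjugate_fin_two] at hcomm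
  simp [mk] at hcomm

theorem closure_proj_eq_top {S : Set (SpecialLinearGroup (Fin 2) F)}
    (h : Subgroup.closure S = ⊤) : Subgroup.closure (proj F '' S) = ⊤ := by
  rw [← MonoidHom.map_closure, h, Subgroup.map_top_of_surjective _ proj_surjective]

theorem eq_top_of_closure_proj {S : Set (SpecialLinearGroup (Fin 2) F)}
    (h : Subgroup.closure (proj F '' S) = ⊤) {P : Subgroup (SpecialLinearGroup (Fin 2) F)}
    (hc : Subgroup.center (SpecialLinearGroup (Fin 2) F) ≤ P) (hS : S ⊆ P) : P = ⊤ := by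
  have map_eq : P.map (proj F) = ⊤ := by
    rw [eq_top_iff, ← h, ← MonoidHom.map_closure]
    exact Subgroup.map_mono ((Subgroup.closure_le P).mpr hS)
  rw [← sup_eq_left.mpr hc, ← QuotientGroup.ker_mk' (Subgroup.center _), ← Subgroup.comap_map_eq,
    map_eq, Subgroup.comap_top]

section Entries

variable {a b c a' b' c' a'' b'' c'' : F} (h : a * -a - b * c = 1) (h' : a' * -a' - b' * c' = 1)
  (h'' : a'' * -a'' - b'' * c'' = 1)
  (hgen : ∀ H : Subgroup (SpecialLinearGroup (Fin 2) F), Mem H a b c (-a) →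
    Mem H a' b' c' (-a') → Mem H a'' b'' c'' (-a'') → H = ⊤)
include hgen

theorem closure_proj_mk_eq_top :
    Subgroup.closure {proj F (mk _ _ _ _ h), proj F (mk _ _ _ _ h'), proj F (mk _ _ _ _ h'')} =
      ⊤ := by
  have mem : ∀ {M : SpecialLinearGroup (Fin 2) F} {s : Set (SpecialLinearGroup (Fin 2) F)},
      M ∈ s → M ∈ Subgroup.closure s := fun h => Subgroup.subset_closure h
  have htop := closure_proj_eq_top (hgen
    (Subgroup.closure {mk _ _ _ _ h, mk _ _ _ _ h', mk _ _ _ _ h''})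
    ⟨_, mem (Or.inl rfl), rfl⟩ ⟨_, mem (Or.inr (Or.inl rfl)), rfl⟩
    ⟨_, mem (Or.inr (Or.inr rfl)), rfl⟩)
  rwa [Set.image_insert_eq, Set.image_pair] at htop

include h h' h''

theorem flagReflections_of_entries (hac : 2 * (a * a'') + b * c'' + c * b'' = 0) :
    GeneratedByFlagReflections (ProjectiveSpecialLinearGroup (Fin 2) F) := by
  have trace_zero {a b c : F} (h : a * -a - b * c = 1) : (mk a b c (-a) h).1.trace = 0 := by
    rw [trace_mk, add_neg_cancel]
  refine ⟨_, _, _, proj_mul_self (trace_zero h), proj_mul_self (trace_zero h'),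
    proj_mul_self (trace_zero h''), proj_comm (trace_zero h) (trace_zero h'') ?_,
    closure_proj_mk_eq_top h h' h'' hgen⟩
  rw [trace_mk_mul_mk]
  linear_combination hac

/-- The trace conditions say that `zx` has order `3` and `zy` has order `4`. -/
theorem asymmetric_of_entries (h2 : (2 : F) ≠ 0)
    (hx : (2 * (a'' * a) + b'' * c + c'' * b) ^ 2 = 1)
    (hy : (2 * (a'' * a') + b'' * c' + c'' * b') ^ 2 = 2) :
    GeneratedByAsymmetricInvolutions (ProjectiveSpecialLinearGroup (Fin 2) F) := by
  have trace_zero {a b c : F} (h : a * -a - b * c = 1) : (mk a b c (-a) h).1.trace = 0 := by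
    rw [trace_mk, add_neg_cancel]
  have ne_one {a b c : F} (h : a * -a - b * c = 1) : proj F (mk a b c (-a) h) ≠ 1 := by
    refine proj_ne_one_of_trace ?_
    rw [trace_zero h]
    exact fun h4 => mul_ne_zero h2 h2 (by linear_combination -h4)
  refine ⟨_, _, _, proj_mul_self (trace_zero h), proj_mul_self (trace_zero h'),
    proj_mul_self (trace_zero h''), ne_one h, ne_one h', ne_one h'',
    closure_proj_mk_eq_top h h' h'' hgen, 3, ?_, ?_⟩
  · rw [← map_mul, proj_pow_three_eq_one_iff, trace_mk_mul_mk]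
    exact Or.inr (by linear_combination hx)
  · rw [← map_mul, ne_eq, proj_pow_three_eq_one_iff, not_or]
    have trace_sq : (mk _ _ _ _ h'' * mk _ _ _ _ h').1.trace ^ 2 = 2 := by
      rw [trace_mk_mul_mk]
      linear_combination hy
    refine ⟨proj_ne_one_of_trace fun h4 => h2 ?_, fun h1 => one_ne_zero (α := F) ?_⟩
    · linear_combination trace_sq - h4
    · linear_combination h1 - trace_sq

end Entries

end Projection

section InvertingAutomorphism

variable {F : Type u} [Field F]

/-- Conjugation by an invertible matrix, as an automorphism of `SL₂(F)`. -/
def conj (g : GL (Fin 2) F) : SpecialLinearGroup (Fin 2) F ≃* SpecialLinearGroup (Fin 2) F where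
  toFun X := ⟨g.1 * X.1 * g⁻¹.1, (det_units_conj g X.1).trans X.2⟩
  invFun X := ⟨g⁻¹.1 * X.1 * g.1, (det_units_conj' g X.1).trans X.2⟩
  left_inv X := Subtype.ext (by simp [mul_assoc])
  right_inv X := Subtype.ext (by simp [mul_assoc])
  map_mul' X Y := Subtype.ext <| by
    change g.1 * (X.1 * Y.1) * g⁻¹.1 = g.1 * X.1 * g⁻¹.1 * (g.1 * Y.1 * g⁻¹.1)
    simp [mul_assoc]

theorem conj_eq_inv {A : SpecialLinearGroup (Fin 2) F} {g : GL (Fin 2) F}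
    (h : A.1 * g.1 * A.1 = g.1) : conj g A = A⁻¹ := by
  refine eq_inv_of_mul_eq_one_right (Subtype.ext ?_)
  change A.1 * (g.1 * A.1 * g⁻¹.1) = 1
  rw [← mul_assoc, ← mul_assoc, h, ← Units.val_mul, mul_inv_cancel, Units.val_one]

theorem mul_commutator_mul (A : SpecialLinearGroup (Fin 2) F) (B : Matrix (Fin 2) (Fin 2) F) :
    A.1 * (A.1 * B - B * A.1) * A.1 = A.1 * B - B * A.1 := by
  have hdet := det_entry A
  ext i j
  fin_cases i <;> fin_cases j <;>
    simp only [Fin.zero_eta, Fin.mk_one, Matrix.mul_apply, Fin.sum_univ_two, Matrix.sub_apply]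
  · linear_combination (A.1 0 1 * B 1 0 - B 0 1 * A.1 1 0) * hdet
  · linear_combination
      (A.1 0 0 * B 0 1 + A.1 0 1 * B 1 1 - B 0 0 * A.1 0 1 - B 0 1 * A.1 1 1) * hdet
  · linear_combination
      (A.1 1 0 * B 0 0 + A.1 1 1 * B 1 0 - B 1 0 * A.1 0 0 - B 1 1 * A.1 1 0) * hdet
  · linear_combination (A.1 1 0 * B 0 1 - B 1 0 * A.1 0 1) * hdet

/-- The elements of `SL₂(F)` that preserve the subspace `W` of `F²`. -/
def subspaceStabilizer (W : Submodule F (Fin 2 → F)) :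
    Subgroup (SpecialLinearGroup (Fin 2) F) where
  carrier := {M | ∀ v, M.1 *ᵥ v ∈ W ↔ v ∈ W}
  one_mem' v := by simp
  mul_mem' {M N} hM hN v := by
    rw [Matrix.SpecialLinearGroup.coe_mul, ← mulVec_mulVec, hM, hN]
  inv_mem' {M} hM v := by
    rw [← hM, mulVec_mulVec, ← Matrix.SpecialLinearGroup.coe_mul, mul_inv_cancel,
      Matrix.SpecialLinearGroup.coe_one, one_mulVec]

theorem center_le_subspaceStabilizer (W : Submodule F (Fin 2 → F)) :
    Subgroup.center (SpecialLinearGroup (Fin 2) F) ≤ subspaceStabilizer W := by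
  intro M hM v
  obtain ⟨r, hr, hrM⟩ := Matrix.SpecialLinearGroup.mem_center_iff.mp hM
  have hr0 : r ≠ 0 := by
    rintro rfl
    simp at hr
  rw [← hrM, scalar_apply, ← smul_one_eq_diagonal, smul_mulVec, one_mulVec, W.smul_mem_iff hr0]

theorem eq_bot_or_eq_top_of_subspaceStabilizer_eq_top {W : Submodule F (Fin 2 → F)}
    (h : subspaceStabilizer W = ⊤) : W = ⊥ ∨ W = ⊤ := by
  have stable (M : SpecialLinearGroup (Fin 2) F) {v : Fin 2 → F} (hv : v ∈ W) : M.1 *ᵥ v ∈ W :=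
    ((h ▸ Subgroup.mem_top M : M ∈ subspaceStabilizer W) v).mpr hv
  have upper {v : Fin 2 → F} (hv : v ∈ W) (h₁ : v 1 ≠ 0) : ![1, 0] ∈ W := by
    refine (W.smul_mem_iff h₁).mp ?_
    convert W.sub_mem (stable (mk 1 1 0 1 (by ring)) hv) hv using 1
    ext i
    fin_cases i <;> simp [mk, dotProduct]
  have lower {v : Fin 2 → F} (hv : v ∈ W) (h₀ : v 0 ≠ 0) : ![0, 1] ∈ W := by
    refine (W.smul_mem_iff h₀).mp ?_
    convert W.sub_mem (stable (mk 1 0 1 1 (by ring)) hv) hv using 1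
    ext i
    fin_cases i <;> simp [mk, dotProduct]
  rw [or_iff_not_imp_left, W.eq_bot_iff]
  intro hW
  push Not at hW
  obtain ⟨v, hv, hv0⟩ := hW
  have basis_mem : ![1, 0] ∈ W ∧ ![0, 1] ∈ W := by
    by_cases h₁ : v 1 = 0
    · have h₀ : v 0 ≠ 0 := fun h₀ => hv0 (by ext i; fin_cases i <;> assumption)
      exact ⟨upper (lower hv h₀) (by simp), lower hv h₀⟩
    · exact ⟨upper hv h₁, lower (upper hv h₁) (by simp)⟩
  refine W.eq_top_iff'.mpr fun w => ?_
  convert W.add_mem (W.smul_mem (w 0) basis_mem.1) (W.smul_mem (w 1) basis_mem.2) using 1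
  ext i
  fin_cases i <;> simp

theorem mem_subspaceStabilizer_ker {A : SpecialLinearGroup (Fin 2) F}
    {N : Matrix (Fin 2) (Fin 2) F} (h : A.1 * N * A.1 = N) :
    A ∈ subspaceStabilizer (LinearMap.ker N.mulVecLin) := by
  have hinv : (A⁻¹).1 * A.1 = 1 := congrArg Subtype.val (inv_mul_cancel A)
  have image_eq (v : Fin 2 → F) : A.1 *ᵥ N *ᵥ A.1 *ᵥ v = N *ᵥ v := by
    rw [mulVec_mulVec, mulVec_mulVec, h]
  intro v
  simp only [LinearMap.mem_ker, mulVecLin_apply]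
  refine ⟨fun hv => by rw [← image_eq, hv, mulVec_zero], fun hv => ?_⟩
  rw [← one_mulVec (N *ᵥ _), ← hinv, ← mulVec_mulVec, image_eq, hv, mulVec_zero]

theorem not_commute_of_closure_pair {A B : SpecialLinearGroup (Fin 2) F}
    (h : Subgroup.closure {proj F A, proj F B} = ⊤) : ¬ Commute A B := by
  intro hAB
  have hcomm := Subgroup.isMulCommutative_closure (k := {proj F A, proj F B}) <| by
    rintro _ (rfl | rfl) _ (rfl | rfl)
    exacts [rfl, hAB.map (proj F), hAB.symm.map (proj F), rfl]
  rw [h] at hcomm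
  exact not_isMulCommutative_psl (F := F) ((isMulCommutative_iff).mpr fun x y =>
    congrArg Subtype.val (hcomm.is_comm.comm ⟨x, Subgroup.mem_top x⟩ ⟨y, Subgroup.mem_top y⟩))

theorem det_commutator_ne_zero {A B : SpecialLinearGroup (Fin 2) F}
    (h : Subgroup.closure {proj F A, proj F B} = ⊤) (hA : A.1 * (A.1 * B.1 - B.1 * A.1) * A.1 =
      A.1 * B.1 - B.1 * A.1) (hB : B.1 * (A.1 * B.1 - B.1 * A.1) * B.1 = A.1 * B.1 - B.1 * A.1) :
    (A.1 * B.1 - B.1 * A.1).det ≠ 0 := by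
  set N := A.1 * B.1 - B.1 * A.1 with hN
  intro hdet
  have stabilizer_eq_top : subspaceStabilizer (LinearMap.ker N.mulVecLin) = ⊤ := by
    refine eq_top_of_closure_proj (S := {A, B}) ?_ (center_le_subspaceStabilizer _) ?_
    · rwa [Set.image_pair]
    · rintro _ (rfl | rfl)
      exacts [mem_subspaceStabilizer_ker hA, mem_subspaceStabilizer_ker hB]
  rcases eq_bot_or_eq_top_of_subspaceStabilizer_eq_top stabilizer_eq_top with hker | hker
  · obtain ⟨v, hv, hNv⟩ := exists_mulVec_eq_zero_iff.mpr hdet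
    exact hv ((Submodule.eq_bot_iff _).mp hker v hNv)
  · rw [LinearMap.ker_eq_top, ← toLin'_apply', LinearEquiv.map_eq_zero_iff, hN, sub_eq_zero] at hker
    exact not_commute_of_closure_pair h (Subtype.ext hker)

/-- Conjugation by the additive commutator `AB - BA` inverts both `A` and `B`. -/
theorem generatingPairsInvertible (F : Type u) [Field F] :
    GeneratingPairsInvertible (ProjectiveSpecialLinearGroup (Fin 2) F) := by
  intro a b hab
  obtain ⟨A, rfl⟩ := proj_surjective a
  obtain ⟨B, rfl⟩ := proj_surjective b
  have hA := mul_commutator_mul A B.1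
  have hB : B.1 * (A.1 * B.1 - B.1 * A.1) * B.1 = A.1 * B.1 - B.1 * A.1 := by
    rw [← neg_sub, mul_neg, neg_mul, mul_commutator_mul]
  let g := GeneralLinearGroup.mkOfDetNeZero _ (det_commutator_ne_zero hab hA hB)
  refine ⟨QuotientGroup.congr _ _ (conj g)
    (Subgroup.characteristic_iff_map_eq.mp inferInstance _), ?_, ?_⟩
  · change proj F (conj g A) = (proj F A)⁻¹
    rw [conj_eq_inv (g := g) hA, map_inv]
  · change proj F (conj g B) = (proj F B)⁻¹
    rw [conj_eq_inv (g := g) hB, map_inv]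

end InvertingAutomorphism

section FlagReflections

variable {F : Type u} [Field F] [Finite F]

theorem card_cast_eq_zero {n : ℕ} (h : Nat.card F = n) : (n : F) = 0 := by
  have := Fintype.ofFinite F
  rw [← h, Nat.card_eq_fintype_card]
  exact FiniteField.cast_card_eq_zero F

theorem eq_zero_of_card_eq_prime_sq {p : ℕ} (h : Nat.card F = p ^ 2) : (p : F) = 0 := by
  have hp := card_cast_eq_zero h
  rwa [Nat.cast_pow, sq_eq_zero_iff] at hp

theorem mem_torus_of_generator {H : Subgroup (SpecialLinearGroup (Fin 2) F)} {ν : Fˣ}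
    (hν : ∀ x, x ∈ Subgroup.zpowers ν) (h : Mem H ν 0 0 (ν : F)⁻¹) (l : F) (hl : l ≠ 0) :
    Mem H l 0 0 l⁻¹ := by
  obtain ⟨k, hk⟩ := mem_powers_iff_mem_zpowers.mpr (hν (Units.mk0 l hl))
  rw [← Units.val_mk0 hl, ← hk]
  clear hk
  induction k with
  | zero => exact Mem.one.congr (by simp) rfl rfl (by simp)
  | succ k ih =>
    refine (ih.mul h).congr ?_ (by ring) (by ring) ?_
    · simp [pow_succ]
    · simp [pow_succ']

theorem flagReflections_of_torus
    (hF : 15 < Nat.card F ∨ ringChar F = 2 ∧ Nat.card F = 8) :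
    GeneratedByFlagReflections (ProjectiveSpecialLinearGroup (Fin 2) F) := by
  obtain ⟨ν, hν⟩ := IsCyclic.exists_generator (α := Fˣ)
  obtain ⟨r, s, hr, hs, hrs⟩ := exists_mul_self_add_mul_self_eq_neg_one (F := F) (by omega)
  refine flagReflections_of_entries (a := 0) (b := 1) (c := -1) (a' := 0) (b' := -(ν : F)⁻¹)
    (c' := ν) (a'' := r) (b'' := s) (c'' := s) (by ring) (by simp) (by linear_combination -hrs)
    (fun H hA hB hC => ?_) (by ring)
  have hAB : Mem H ν 0 0 (ν : F)⁻¹ := (hA.mul hB).congr (by ring) (by ring) (by ring) (by ring)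
  exact eq_top_of_torus (mem_torus_of_generator hν hAB) hF hC hr hs hs (neg_ne_zero.mpr hr)

theorem addSubgroup_eq_top_of_lt_card {A : Type*} [AddGroup A] {p : ℕ} (hp : p.Prime)
    (hA : Nat.card A = p ^ 2) {X : AddSubgroup A} (hX : p < Nat.card X) : X = ⊤ := by
  have : Finite A := Nat.finite_of_card_ne_zero (hA ▸ pow_ne_zero 2 hp.ne_zero)
  obtain ⟨k, hk, hcard⟩ := (Nat.dvd_prime_pow hp).mp (hA ▸ X.card_addSubgroup_dvd_card)
  have hk2 : k = 2 := by
    refine hk.antisymm (Nat.lt_of_not_le fun hk1 => hX.not_ge ?_)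
    exact hcard.trans_le ((Nat.pow_le_pow_right hp.pos hk1).trans_eq (pow_one p))
  exact X.eq_top_of_card_eq (by rw [hcard, hk2, hA])

theorem eq_top_of_card_eq_prime_sq {p : ℕ} (hp : p.Prime) (hF : Nat.card F = p ^ 2)
    {H : Subgroup (SpecialLinearGroup (Fin 2) F)} {S : Finset F} (hS : ∀ t ∈ S, t ∈ unipotents H)
    (hcard : p < S.card) {a b c d : F} (h : Mem H a b c d) (hc : c ≠ 0) : H = ⊤ := by
  refine eq_top_of_unipotents (addSubgroup_eq_top_of_lt_card hp hF (hcard.trans_le ?_)) h hc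
  rw [← Set.ncard_coe_finset]
  exact Set.ncard_le_ncard hS (Set.toFinite _)

omit [Finite F] in
theorem eq_top_of_prime_card (hF : (Nat.card F).Prime)
    {H : Subgroup (SpecialLinearGroup (Fin 2) F)} {t : F} (ht : t ∈ unipotents H) (ht0 : t ≠ 0)
    {a b c d : F} (h : Mem H a b c d) (hc : c ≠ 0) : H = ⊤ := by
  have := Fact.mk hF
  refine eq_top_of_unipotents ?_ h hc
  refine (unipotents H).eq_bot_or_eq_top_of_prime_card.resolve_left fun hbot => ht0 ?_
  rwa [hbot, AddSubgroup.mem_bot] at ht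

theorem flagReflections_of_card_four (hF : Nat.card F = 4) :
    GeneratedByFlagReflections (ProjectiveSpecialLinearGroup (Fin 2) F) := by
  classical
  have := Fintype.ofFinite F
  have h2 : (2 : F) = 0 := eq_zero_of_card_eq_prime_sq (p := 2) hF
  obtain ⟨x, -, hx⟩ : ∃ x ∈ Finset.univ, x ∉ ({0, 1} : Finset F) := by
    refine Finset.exists_mem_notMem_of_card_lt_card (Finset.card_le_two.trans_lt ?_)
    rw [Finset.card_univ, ← Nat.card_eq_fintype_card, hF]
    norm_num
  simp only [Finset.mem_insert, Finset.mem_singleton, not_or] at hx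
  refine flagReflections_of_entries (a := 1) (b := 1) (c := 0) (a' := 0) (b' := 1) (c' := 1)
    (a'' := 1) (b'' := x) (c'' := 0) (by linear_combination -h2) (by linear_combination -h2)
    (by linear_combination -h2) (fun H hA hB hC => ?_) (by linear_combination h2)
  refine eq_top_of_card_eq_prime_sq Nat.prime_two hF (S := {0, 1, x}) ?_ ?_ hB one_ne_zero
  · simp only [Finset.mem_insert, Finset.mem_singleton, forall_eq_or_imp, forall_eq]
    exact ⟨zero_mem _, hA.congr rfl rfl rfl (by linear_combination -h2),
      hC.congr rfl rfl rfl (by linear_combination -h2)⟩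
  · simp [Ne.symm hx.1, Ne.symm hx.2]

omit [Finite F] in
theorem flagReflections_of_prime (hF : (Nat.card F).Prime) {i : F} (hi : i * i = -1) :
    GeneratedByFlagReflections (ProjectiveSpecialLinearGroup (Fin 2) F) := by
  refine flagReflections_of_entries (a := i) (b := 0) (c := 0) (a' := i) (b' := i) (c' := 0)
    (a'' := 0) (b'' := 1) (c'' := -1) (by linear_combination -hi) (by linear_combination -hi)
    (by ring) (fun H hA hB hC => ?_) (by ring)
  have one_mem : 1 ∈ unipotents H := (hA.inv.mul hB).congr (by linear_combination -hi)
    (by linear_combination -hi) (by ring) (by linear_combination -hi)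
  exact eq_top_of_prime_card hF one_mem one_ne_zero hC (neg_ne_zero.mpr one_ne_zero)

theorem flagReflections_of_card_eleven (hF : Nat.card F = 11) :
    GeneratedByFlagReflections (ProjectiveSpecialLinearGroup (Fin 2) F) := by
  have h11 : (11 : F) = 0 := mod_cast card_cast_eq_zero hF
  refine flagReflections_of_entries (a := 0) (b := 1) (c := -1) (a' := 1) (b' := 2) (c' := -1)
    (a'' := 1) (b'' := 3) (c'' := 3) (by ring) (by ring) (by linear_combination -h11)
    (fun H hA hB hC => ?_) (by ring)
  have hW : Mem H (-1) 5 0 (-1) :=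
    ((((((hA.mul hB).mul hA).mul hB).mul hC).mul hB).mul hC).congr
      (by linear_combination 6 * h11) (by ring) (by linear_combination 10 * h11)
      (by linear_combination h11)
  refine eq_top_of_prime_card (hF ▸ by norm_num) (hW.two_mul_mem_unipotents (by ring))
    (fun h0 => one_ne_zero (α := F) ?_) hA (neg_ne_zero.mpr one_ne_zero)
  linear_combination h11 + h0

theorem asymmetric_of_card_seven (hF : Nat.card F = 7) :
    GeneratedByAsymmetricInvolutions (ProjectiveSpecialLinearGroup (Fin 2) F) := by
  have h7 : (7 : F) = 0 := mod_cast card_cast_eq_zero hF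
  refine asymmetric_of_entries (a := 2) (b := 1) (c := 2) (a' := 1) (b' := 1) (c' := -2)
    (a'' := 0) (b'' := 1) (c'' := -1) (by linear_combination -h7) (by ring) (by ring)
    (fun H hx hy hz => ?_) (fun h2 => one_ne_zero (α := F) (by linear_combination h7 - 3 * h2))
    (by ring) (by linear_combination h7)
  have hW : Mem H (-1) 4 0 (-1) := ((hz.mul hx).mul hy).congr (by linear_combination h7) (by ring)
    (by ring) (by ring)
  refine eq_top_of_prime_card (hF ▸ by norm_num) (hW.two_mul_mem_unipotents (by ring))
    (fun h0 => one_ne_zero (α := F) ?_) hz (neg_ne_zero.mpr one_ne_zero)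
  linear_combination -h7 - h0

theorem asymmetric_of_card_nine (hF : Nat.card F = 9) :
    GeneratedByAsymmetricInvolutions (ProjectiveSpecialLinearGroup (Fin 2) F) := by
  classical
  have := Fintype.ofFinite F
  have h3 : (3 : F) = 0 := eq_zero_of_card_eq_prime_sq (p := 3) hF
  obtain ⟨i, hi⟩ : IsSquare (-1 : F) := FiniteField.isSquare_neg_one_iff.mpr
    (by rw [← Nat.card_eq_fintype_card, hF]; norm_num)
  have h2 : (2 : F) ≠ 0 := fun h2 => one_ne_zero (α := F) (by linear_combination h3 - h2)
  refine asymmetric_of_entries (a := i) (b := 0) (c := 1) (a' := 0) (b' := 1 + i) (c' := 1 - i)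
    (a'' := 0) (b'' := 1) (c'' := -1) (by linear_combination hi)
    (by linear_combination -hi - h3) (by ring) (fun H hx hy hz => ?_) h2 (by ring)
    (by linear_combination -4 * hi - 2 * h3)
  have i_mem : i ∈ unipotents H := ((((hz.mul hx).mul hy).mul hz).mul hy).congr
    (by linear_combination -(2 - i) * hi - h3) (by linear_combination hi - i * h3) (by ring)
    (by linear_combination -(2 + i) * hi - h3)
  have two_mem : 2 ∈ unipotents H := ((((hz.mul hy).mul hz).mul hx).mul hy).congr
    (by linear_combination -(2 - i) * hi - h3) (by linear_combination hi) (by ring)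
    (by linear_combination -(2 + i) * hi - h3)
  have one_mem : 1 ∈ unipotents H := by
    convert add_mem two_mem two_mem using 1
    linear_combination -h3
  have hi0 : i ≠ 0 := by
    rintro rfl
    simp at hi
  have hi1 : i ≠ 1 := fun h => h2 (by rw [h] at hi; linear_combination -hi)
  have hi2 : i ≠ 2 := fun h => h2 (by rw [h] at hi; linear_combination -hi - h3)
  refine eq_top_of_card_eq_prime_sq Nat.prime_three hF (S := {i, 0, 1, 2}) ?_ ?_ hz
    (neg_ne_zero.mpr one_ne_zero)
  · simp only [Finset.mem_insert, Finset.mem_singleton, forall_eq_or_imp, forall_eq]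
    exact ⟨i_mem, zero_mem _, one_mem, two_mem⟩
  · have h12 : (1 : F) ≠ 2 := fun h => one_ne_zero (α := F) (by linear_combination -h)
    simp [hi0, hi1, hi2, h12, h2.symm]

end FlagReflections

section Quaternions

/-- The standard bilinear form on triples. -/
def dot {R : Type u} [CommRing R] (v w : R × R × R) : R :=
  v.1 * w.1 + v.2.1 * w.2.1 + v.2.2 * w.2.2

/-- The half-turn about the line spanned by a vector `w` with `dot w w = 1`. -/
def halfTurn {R : Type u} [CommRing R] (w v : R × R × R) : R × R × R :=
  (2 * dot v w) • w - v

/-- The pure quaternion with coordinates `v`, for anticommuting square roots `I`, `J` of `-1`. -/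
def quat {R : Type u} [CommRing R] {A : Type v} [Ring A] [Algebra R A] (I J : A)
    (v : R × R × R) : A :=
  v.1 • I + v.2.1 • J + v.2.2 • (I * J)

variable {R : Type u} [CommRing R] {A : Type v} [Ring A] [Algebra R A] {I J : A}

theorem quat_neg (v : R × R × R) : quat I J (-v) = -quat I J v := by
  simp only [quat, Prod.fst_neg, Prod.snd_neg]
  module

section Relations

variable (hI : I * I = -1) (hJ : J * J = -1) (hJI : J * I = -(I * J))
include hI hJ hJI

theorem quat_anticommutator (v w : R × R × R) :
    quat I J v * quat I J w + quat I J w * quat I J v = (-2 * dot v w) • (1 : A) := by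
  have hI' (X : A) : I * (I * X) = -X := by rw [← mul_assoc, hI, neg_one_mul]
  have hJI' (X : A) : J * (I * X) = -(I * (J * X)) := by rw [← mul_assoc, hJI, neg_mul, mul_assoc]
  simp only [quat, dot, add_mul, mul_add, smul_mul_assoc, mul_smul_comm, mul_assoc, hI, hJ, hJI,
    hI', hJI', mul_neg, mul_one, neg_neg]
  module

theorem quat_mul_self (v : R × R × R) : quat I J v * quat I J v = -dot v v • (1 : A) := by
  have hI' (X : A) : I * (I * X) = -X := by rw [← mul_assoc, hI, neg_one_mul]
  have hJI' (X : A) : J * (I * X) = -(I * (J * X)) := by rw [← mul_assoc, hJI, neg_mul, mul_assoc]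
  simp only [quat, dot, add_mul, mul_add, smul_mul_assoc, mul_smul_comm, mul_assoc, hI, hJ, hJI,
    hI', hJI', mul_neg, mul_one, neg_neg]
  module

theorem quat_halfTurn {w : R × R × R} (hw : dot w w = 1) (v : R × R × R) :
    quat I J w * quat I J v * -quat I J w = quat I J (halfTurn w v) := by
  have swap := eq_sub_of_add_eq' (quat_anticommutator hI hJ hJI v w)
  have quat_eq : quat I J (halfTurn w v) = (2 * dot v w) • quat I J w - quat I J v := by
    simp only [quat, halfTurn, Prod.fst_sub, Prod.snd_sub, Prod.smul_fst, Prod.smul_snd]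
    module
  rw [swap, mul_neg, sub_mul, mul_assoc, quat_mul_self hI hJ hJI, hw, quat_eq]
  simp only [smul_mul_assoc, one_mul, mul_smul_comm, mul_one]
  module

end Relations

theorem eq_zero_of_anticommute {F : Type u} [Field F] [Algebra F A] (h2 : (2 : F) ≠ 0)
    (hI : I * I = -1) (hJ : J * J = -1) {Y : A} (hYI : Y * I = -(I * Y)) (hYJ : Y * J = -(J * Y))
    (hYIJ : Y * (I * J) = -(I * J * Y)) : Y = 0 := by
  have hcomm : Y * (I * J) = I * J * Y := by
    rw [← mul_assoc, hYI, neg_mul, mul_assoc, hYJ, mul_neg, neg_neg, mul_assoc]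
  have hdouble : (2 : F) • (I * J * Y) = 0 := by
    rw [two_smul, ← eq_neg_iff_add_eq_zero, ← hYIJ, hcomm]
  have hzero : I * J * Y = 0 := (smul_eq_zero.mp hdouble).resolve_left h2
  calc Y = J * (I * (I * J * Y)) := by
        rw [mul_assoc I, ← mul_assoc I, hI, neg_one_mul, mul_neg, ← mul_assoc, hJ, neg_one_mul,
          neg_neg]
    _ = 0 := by rw [hzero, mul_zero, mul_zero]

end Quaternions

section TracelessMatrices

theorem anticommutator_of_trace_eq_zero {R : Type u} [CommRing R] {X Y : Matrix (Fin 2) (Fin 2) R}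
    (hX : X.trace = 0) (hY : Y.trace = 0) :
    X * Y + Y * X = (X * Y).trace • (1 : Matrix (Fin 2) (Fin 2) R) := by
  rw [trace_fin_two] at *
  ext i j
  fin_cases i <;> fin_cases j <;>
    simp only [Fin.zero_eta, Fin.mk_one, Fin.isValue, Matrix.add_apply, Matrix.mul_apply,
      Fin.sum_univ_two, Matrix.smul_apply, smul_eq_mul, one_apply_eq, mul_one, ne_eq, zero_ne_one,
      one_ne_zero, not_false_eq_true, one_apply_ne, mul_zero]
  · linear_combination Y 0 0 * hX - X 1 1 * hY
  · linear_combination Y 0 1 * hX + X 0 1 * hY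
  · linear_combination Y 1 0 * hX + X 1 0 * hY
  · linear_combination Y 1 1 * hX - X 0 0 * hY

variable {F : Type u} [Field F]

theorem exists_quat_eq (h2 : (2 : F) ≠ 0) {I J : Matrix (Fin 2) (Fin 2) F} (hI : I * I = -1)
    (hJ : J * J = -1) (hJI : J * I = -(I * J)) (hI0 : I.trace = 0) (hJ0 : J.trace = 0)
    (hIJ0 : (I * J).trace = 0) {X : Matrix (Fin 2) (Fin 2) F} (hX : X.trace = 0) :
    ∃ w : F × F × F, X = quat I J w := by
  let w : F × F × F := (-(X * I).trace / 2, -(X * J).trace / 2, -(X * (I * J)).trace / 2)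
  have anti (e : F × F × F) (he : (X * quat I J e).trace = -2 * dot w e)
      (he0 : (quat I J e).trace = 0) :
      (X - quat I J w) * quat I J e = -(quat I J e * (X - quat I J w)) := by
    have hsum := anticommutator_of_trace_eq_zero hX he0
    rw [he, ← quat_anticommutator hI hJ hJI w e] at hsum
    rw [sub_mul, mul_sub, eq_neg_iff_add_eq_zero, ← sub_eq_zero_of_eq hsum]
    abel
  have antiI := anti (1, 0, 0) (by simp [quat, dot, w]; field_simp) (by simp [quat, hI0])
  have antiJ := anti (0, 1, 0) (by simp [quat, dot, w]; field_simp) (by simp [quat, hJ0])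
  have antiIJ := anti (0, 0, 1) (by simp [quat, dot, w]; field_simp) (by simp [quat, hIJ0])
  simp only [quat, one_smul, zero_smul, add_zero, zero_add] at antiI antiJ antiIJ
  exact ⟨w, sub_eq_zero.mp (eq_zero_of_anticommute h2 hI hJ antiI antiJ antiIJ)⟩

theorem coe_inv_of_trace_eq_zero {M : SpecialLinearGroup (Fin 2) F} (hM : M.1.trace = 0) :
    (M⁻¹).1 = -M.1 := by
  rw [trace_fin_two] at hM
  rw [Matrix.SpecialLinearGroup.coe_inv, adjugate_fin_two]
  ext i j
  fin_cases i <;> fin_cases j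
  · exact eq_neg_of_add_eq_zero_right hM
  · rfl
  · rfl
  · exact eq_neg_of_add_eq_zero_left hM

theorem mul_self_of_trace_eq_zero {M : SpecialLinearGroup (Fin 2) F} (hM : M.1.trace = 0) :
    M.1 * M.1 = -1 := by
  have hinv : M.1 * (M⁻¹).1 = 1 := congrArg Subtype.val (mul_inv_cancel M)
  rw [coe_inv_of_trace_eq_zero hM, mul_neg] at hinv
  exact neg_eq_iff_eq_neg.mp hinv

theorem trace_eq_zero_of_proj {M : SpecialLinearGroup (Fin 2) F}
    (hM : proj F M * proj F M = 1) (hM_ne : proj F M ≠ 1) : M.1.trace = 0 := by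
  rw [← map_mul, proj_eq_one_iff] at hM
  simp only [mul_entry] at hM
  obtain ⟨h₀₁, h₁₀, hdiag⟩ := hM
  by_contra h0
  refine hM_ne (proj_eq_one_iff.mpr ⟨?_, ?_, ?_⟩) <;> rw [trace_fin_two] at h0
  · exact (mul_eq_zero_iff_left h0).mp (by linear_combination h₀₁)
  · exact (mul_eq_zero_iff_left h0).mp (by linear_combination h₁₀)
  · exact sub_eq_zero.mp ((mul_eq_zero_iff_left h0).mp (by linear_combination hdiag))

end TracelessMatrices

open scoped Pointwise

section Counting

variable {F : Type u} [Field F]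

/-- The elements of `SL₂(F)` conjugating a set of matrices to itself. -/
def setStabilizer (T : Set (Matrix (Fin 2) (Fin 2) F)) :
    Subgroup (SpecialLinearGroup (Fin 2) F) where
  carrier := {M | ∀ X, M.1 * X * (M⁻¹).1 ∈ T ↔ X ∈ T}
  one_mem' X := by
    rw [inv_one, Matrix.SpecialLinearGroup.coe_one, one_mul, mul_one]
  mul_mem' {M N} hM hN X := by
    rw [_root_.mul_inv_rev, Matrix.SpecialLinearGroup.coe_mul, Matrix.SpecialLinearGroup.coe_mul,
      ← hN X, ← hM (N.1 * X * (N⁻¹).1)]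
    simp only [mul_assoc]
  inv_mem' {M} hM X := by
    have hinv : M.1 * (M⁻¹).1 = 1 := congrArg Subtype.val (mul_inv_cancel M)
    rw [← hM, inv_inv, mul_assoc, mul_assoc, hinv, mul_one, ← mul_assoc, hinv, one_mul]

theorem center_le_setStabilizer (T : Set (Matrix (Fin 2) (Fin 2) F)) :
    Subgroup.center (SpecialLinearGroup (Fin 2) F) ≤ setStabilizer T := by
  intro M hM X
  obtain ⟨r, -, hr⟩ := Matrix.SpecialLinearGroup.mem_center_iff.mp hM
  have hcomm : M.1 * X = X * M.1 := by
    rw [← hr]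
    exact scalar_commute r (Commute.all r) X
  have hinv : M.1 * (M⁻¹).1 = 1 := congrArg Subtype.val (mul_inv_cancel M)
  rw [hcomm, mul_assoc, hinv, mul_one]

theorem mk_mul_traceless_mul_inv (t : F) {X : Matrix (Fin 2) (Fin 2) F} (hX : X.trace = 0) :
    (mk 1 t 0 1 (by ring)).1 * X * (mk 1 t 0 1 (by ring))⁻¹.1 =
      !![X 0 0 + t * X 1 0, X 0 1 - 2 * t * X 0 0 - t ^ 2 * X 1 0;
        X 1 0, -(X 0 0 + t * X 1 0)] := by
  rw [trace_fin_two] at hX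
  rw [Matrix.SpecialLinearGroup.coe_inv]
  ext i j
  fin_cases i <;> fin_cases j <;>
    simp only [mk, adjugate_fin_two_of, Matrix.mul_apply, Fin.sum_univ_two, Fin.zero_eta,
      Fin.mk_one, Fin.isValue, of_apply, cons_val', cons_val_zero, cons_val_one, cons_val_fin_one]
  · ring
  · linear_combination t * hX
  · ring
  · linear_combination hX

theorem conj_unipotent_injective (h2 : (2 : F) ≠ 0) {X : Matrix (Fin 2) (Fin 2) F}
    (hX : X.trace = 0) (hX0 : X * X ≠ 0) {s t ε : F}
    (hst : (mk 1 s 0 1 (by ring)).1 * X * (mk 1 s 0 1 (by ring))⁻¹.1 =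
      ε • ((mk 1 t 0 1 (by ring)).1 * X * (mk 1 t 0 1 (by ring))⁻¹.1)) : s = t := by
  rw [mk_mul_traceless_mul_inv s hX, mk_mul_traceless_mul_inv t hX] at hst
  have h₀₀ : X 0 0 + s * X 1 0 = ε * (X 0 0 + t * X 1 0) := congrFun₂ hst 0 0
  have h₁₀ : X 1 0 = ε * X 1 0 := congrFun₂ hst 1 0
  have h₀₁ : X 0 1 - 2 * s * X 0 0 - s ^ 2 * X 1 0 =
      ε * (X 0 1 - 2 * t * X 0 0 - t ^ 2 * X 1 0) := congrFun₂ hst 0 1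
  by_cases hz : X 1 0 = 0
  · have hx : X 0 0 ≠ 0 := by
      intro hx
      rw [trace_fin_two, hx, zero_add] at hX
      refine hX0 (ext fun i j => ?_)
      fin_cases i <;> fin_cases j <;> simp [Matrix.mul_apply, hx, hX, hz]
    rw [hz, mul_zero, add_zero, mul_zero, add_zero] at h₀₀
    have hε1 : ε = 1 := mul_right_cancel₀ hx (by rw [← h₀₀, one_mul])
    rw [hz, hε1] at h₀₁
    exact mul_left_cancel₀ (mul_ne_zero h2 hx) (by linear_combination -h₀₁)
  · have hε1 : ε = 1 := mul_right_cancel₀ hz (by rw [← h₁₀, one_mul])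
    rw [hε1] at h₀₀
    exact mul_right_cancel₀ hz (by linear_combination h₀₀)

theorem card_le_ncard [Finite F] (h2 : (2 : F) ≠ 0) {S : Set (Matrix (Fin 2) (Fin 2) F)}
    (hS : S.Nonempty) (htr : ∀ X ∈ S, X.trace = 0) (hsq : ∀ X ∈ S, X * X ≠ 0)
    (htop : setStabilizer (S ∪ -S) = ⊤) : Nat.card F ≤ S.ncard := by
  obtain ⟨X, hX⟩ := hS
  have orbit (t : F) : ∃ Y : S, ∃ ε : F, ε * ε = 1 ∧
      (mk 1 t 0 1 (by ring)).1 * X * (mk 1 t 0 1 (by ring))⁻¹.1 = ε • Y.1 := by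
    have mem : mk 1 t 0 1 (by ring) ∈ setStabilizer (S ∪ -S) := htop ▸ Subgroup.mem_top _
    rcases (mem X).mpr (Or.inl hX) with h | h
    · exact ⟨⟨_, h⟩, 1, one_mul 1, (one_smul F _).symm⟩
    · refine ⟨⟨_, h⟩, -1, by ring, ?_⟩
      rw [neg_one_smul, neg_neg]
  choose Y ε hε hY using orbit
  refine Nat.card_le_card_of_injective Y fun s t hst => ?_
  refine conj_unipotent_injective h2 (htr X hX) (hsq X hX) (ε := ε s * ε t) ?_
  rw [hY s, hY t, hst, smul_smul, mul_assoc, hε, mul_one]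

end Counting

section Configurations

/-- The lines spanned by the members of `l` are permuted by the half-turn about `w`. -/
def HalfTurnStable {R : Type u} [CommRing R] (w : R × R × R) (l : List (R × R × R)) : Prop :=
  ∀ v ∈ l, halfTurn w v ∈ l ∨ -halfTurn w v ∈ l

instance {R : Type u} [CommRing R] [DecidableEq R] (w : R × R × R) (l : List (R × R × R)) :
    Decidable (HalfTurnStable w l) :=
  inferInstanceAs (Decidable (∀ v ∈ l, halfTurn w v ∈ l ∨ -halfTurn w v ∈ l))

variable {F : Type u} [Field F]

theorem mem_setStabilizer_of_halfTurnStable {I J : Matrix (Fin 2) (Fin 2) F} (hI : I * I = -1)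
    (hJ : J * J = -1) (hJI : J * I = -(I * J)) {M : SpecialLinearGroup (Fin 2) F}
    (hM : M.1.trace = 0) {w : F × F × F} (hw : dot w w = 1) (hMw : M.1 = quat I J w)
    {l : List (F × F × F)} (hl : HalfTurnStable w l) :
    M ∈ setStabilizer (quat I J '' {v | v ∈ l} ∪ -(quat I J '' {v | v ∈ l})) := by
  have conj_mem (X) (hX : X ∈ quat I J '' {v | v ∈ l} ∪ -(quat I J '' {v | v ∈ l})) :
      M.1 * X * -M.1 ∈ quat I J '' {v | v ∈ l} ∪ -(quat I J '' {v | v ∈ l}) := by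
    rcases hX with ⟨v, hv, rfl⟩ | ⟨v, hv, hX⟩
    · rw [hMw, quat_halfTurn hI hJ hJI hw]
      refine (hl v hv).imp (fun h => ⟨_, h, rfl⟩) (fun h => ⟨_, h, quat_neg _⟩)
    · rw [← neg_neg X, ← hX, mul_neg M.1, neg_mul, hMw, quat_halfTurn hI hJ hJI hw]
      refine (hl v hv).symm.imp (fun h => ⟨_, h, quat_neg _⟩) (fun h => ⟨_, h, (neg_neg _).symm⟩)
  intro X
  rw [coe_inv_of_trace_eq_zero hM]
  refine ⟨fun h => ?_, conj_mem X⟩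
  have hMM := mul_self_of_trace_eq_zero hM
  have hX : M.1 * (M.1 * X * -M.1) * -M.1 = X := by
    rw [mul_neg, mul_neg, mul_neg, neg_mul, neg_neg, mul_assoc, mul_assoc, mul_assoc, hMM,
      ← mul_assoc, hMM, mul_neg_one, neg_one_mul, neg_neg]
  exact hX ▸ conj_mem _ h

theorem card_le_length [Finite F] (h2 : (2 : F) ≠ 0) {I J : Matrix (Fin 2) (Fin 2) F}
    (hI : I * I = -1) (hJ : J * J = -1) (hJI : J * I = -(I * J)) (hI0 : I.trace = 0)
    (hJ0 : J.trace = 0) (hIJ0 : (I * J).trace = 0) {l : List (F × F × F)} (hl : l ≠ [])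
    (hdot : ∀ v ∈ l, dot v v ≠ 0)
    (htop : setStabilizer (quat I J '' {v | v ∈ l} ∪ -(quat I J '' {v | v ∈ l})) = ⊤) :
    Nat.card F ≤ l.length := by
  have hne : (quat (R := F) I J '' {v | v ∈ l}).Nonempty :=
    Set.Nonempty.image _ (List.exists_mem_of_ne_nil l hl)
  refine (card_le_ncard h2 hne ?_ ?_ htop).trans ?_
  · rintro _ ⟨v, -, rfl⟩
    simp [quat, trace_add, trace_smul, hI0, hJ0, hIJ0]
  · rintro _ ⟨v, hv, rfl⟩
    rw [quat_mul_self hI hJ hJI]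
    exact smul_ne_zero (neg_ne_zero.mpr (hdot v hv)) one_ne_zero
  · classical
    rw [← List.coe_toFinset]
    exact (Set.ncard_image_le (Finset.finite_toSet _)).trans
      ((Set.ncard_coe_finset _).trans_le l.toFinset_card_le)

theorem exists_unit_forall_card_le_length [Finite F] (h2 : (2 : F) ≠ 0)
    {A B C : SpecialLinearGroup (Fin 2) F} (hA : A.1.trace = 0) (hB : B.1.trace = 0)
    (hC : C.1.trace = 0) (hAC : (A * C).1.trace = 0)
    (hgen : Subgroup.closure (proj F '' {A, B, C}) = ⊤) :
    ∃ w : F × F × F, dot w w = 1 ∧ ∀ l : List (F × F × F), l ≠ [] → (∀ v ∈ l, dot v v ≠ 0) →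
      HalfTurnStable (1, 0, 0) l → HalfTurnStable (0, 1, 0) l → HalfTurnStable w l →
      Nat.card F ≤ l.length := by
  rw [Matrix.SpecialLinearGroup.coe_mul] at hAC
  have hI := mul_self_of_trace_eq_zero hA
  have hJ := mul_self_of_trace_eq_zero hC
  have hJI : C.1 * A.1 = -(A.1 * C.1) := by
    have hsum := anticommutator_of_trace_eq_zero hA hC
    rw [hAC, zero_smul] at hsum
    exact eq_neg_of_add_eq_zero_right hsum
  obtain ⟨w, hBw⟩ := exists_quat_eq h2 hI hJ hJI hA hC hAC hB
  have hw : dot w w = 1 := by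
    have hsq := mul_self_of_trace_eq_zero hB
    rw [hBw, quat_mul_self hI hJ hJI, neg_smul, neg_inj] at hsq
    exact smul_left_injective F one_ne_zero (hsq.trans (one_smul F _).symm)
  refine ⟨w, hw, fun l hl hdot hlA hlC hlB => ?_⟩
  have htop : setStabilizer (quat A.1 C.1 '' {v | v ∈ l} ∪ -(quat A.1 C.1 '' {v | v ∈ l})) = ⊤ := by
    refine eq_top_of_closure_proj hgen (center_le_setStabilizer _) ?_
    have stable {M : SpecialLinearGroup (Fin 2) F} (hM : M.1.trace = 0) {w : F × F × F}
        (hw : dot w w = 1) (hMw : M.1 = quat A.1 C.1 w) (hlw : HalfTurnStable w l) :=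
      mem_setStabilizer_of_halfTurnStable hI hJ hJI hM hw hMw hlw
    rintro M (rfl | rfl | rfl)
    · exact stable hA (by simp [dot]) (by simp [quat]) hlA
    · exact stable hB hw hBw hlB
    · exact stable hC (by simp [dot]) (by simp [quat]) hlC
  exact card_le_length h2 hI hJ hJI hA hC hAC hl hdot htop

theorem not_flagReflections_of_configurations [Finite F]
    [IsSimpleGroup (ProjectiveSpecialLinearGroup (Fin 2) F)] (h2 : (2 : F) ≠ 0)
    (L : List (List (F × F × F)))
    (hL : ∀ l ∈ L, l ≠ [] ∧ l.length < Nat.card F ∧ (∀ v ∈ l, dot v v ≠ 0) ∧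
      HalfTurnStable (1, 0, 0) l ∧ HalfTurnStable (0, 1, 0) l)
    (hunit : ∀ w : F × F × F, dot w w = 1 → ∃ l ∈ L, HalfTurnStable w l) :
    ¬ GeneratedByFlagReflections (ProjectiveSpecialLinearGroup (Fin 2) F) := by
  intro h
  obtain ⟨a, b, c, ha, hb, hc, hac, hgen, a_ne, b_ne, c_ne, ac_ne⟩ :=
    h.exists_ne_one not_isMulCommutative_psl
  have hac2 : (a * c) * (a * c) = 1 := by
    rw [← sq, Commute.mul_pow hac, sq, sq, ha, hc, one_mul]
  obtain ⟨A, rfl⟩ := proj_surjective a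
  obtain ⟨B, rfl⟩ := proj_surjective b
  obtain ⟨C, rfl⟩ := proj_surjective c
  rw [← map_mul] at ac_ne hac2
  rw [← Set.image_pair, ← Set.image_insert_eq] at hgen
  obtain ⟨w, hw, hcard⟩ := exists_unit_forall_card_le_length h2 (trace_eq_zero_of_proj ha a_ne)
    (trace_eq_zero_of_proj hb b_ne) (trace_eq_zero_of_proj hc c_ne)
    (trace_eq_zero_of_proj hac2 ac_ne) hgen
  obtain ⟨l, hl, hlw⟩ := hunit w hw
  obtain ⟨hne, hlt, hdot, hlA, hlC⟩ := hL l hl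
  exact (hcard l hne hdot hlA hlC hlw).not_gt hlt

/-- The principal axis of a dihedral group, or the three fourfold axes of an octahedral group, in
the positions for which the group contains the half-turns about `e₁` and `e₂`; here `h² = 1 / 2`. -/
def frames {R : Type u} [CommRing R] (h : R) : List (List (R × R × R)) :=
  [[(1, 0, 0)], [(0, 1, 0)], [(1, 0, 0), (0, 1, 0), (0, 0, 1)],
    [(1, 0, 0), (0, h, h), (0, h, -h)], [(0, 1, 0), (h, 0, h), (h, 0, -h)],
    [(0, 0, 1), (h, h, 0), (h, -h, 0)]]

/-- The axes through the vertices of an icosahedron, for a root `r` of `r² = r + 1`. -/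
def icosahedron {R : Type u} [CommRing R] (r : R) : List (R × R × R) :=
  [(0, 1, r), (0, 1, -r), (r, 0, 1), (-r, 0, 1), (1, r, 0), (1, -r, 0)]

instance : Fact (Nat.Prime 7) := ⟨by norm_num⟩

theorem not_flagReflections_zmod_seven
    [IsSimpleGroup (ProjectiveSpecialLinearGroup (Fin 2) (ZMod 7))] :
    ¬ GeneratedByFlagReflections (ProjectiveSpecialLinearGroup (Fin 2) (ZMod 7)) := by
  refine not_flagReflections_of_configurations (by decide) (frames 2) ?_ (by decide +kernel)
  rw [Nat.card_zmod]
  decide +kernel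

/-- The field of nine elements. -/
abbrev F9 : Type := QuadraticAlgebra (ZMod 3) (-1) 0

instance : Fintype F9 :=
  Fintype.ofEquiv _ (QuadraticAlgebra.equivProd (-1 : ZMod 3) 0).symm

instance : Fact (∀ r : ZMod 3, r ^ 2 ≠ -1 + 0 * r) := ⟨by decide⟩

theorem card_F9 : Fintype.card F9 = 9 := rfl

theorem not_flagReflections_F9 [IsSimpleGroup (ProjectiveSpecialLinearGroup (Fin 2) F9)] :
    ¬ GeneratedByFlagReflections (ProjectiveSpecialLinearGroup (Fin 2) F9) := by
  have hunit : ∀ w : F9 × F9 × F9, dot w w = 1 → ∃ l ∈ frames (⟨0, 1⟩ : F9) ++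
      [icosahedron ⟨-1, 1⟩, icosahedron ⟨-1, -1⟩], HalfTurnStable w l := by
    decide +kernel
  refine not_flagReflections_of_configurations (by decide +kernel) _ ?_ hunit
  rw [Nat.card_eq_fintype_card, card_F9]
  decide +kernel

end Configurations

section Transport

theorem map_center_mulEquiv {G : Type u} [Group G] {H : Type v} [Group H] (e : G ≃* H) :
    (Subgroup.center G).map (e : G →* H) = Subgroup.center H := by
  rw [Subgroup.map_equiv_eq_comap_symm]
  ext h
  simp only [Subgroup.mem_comap, Subgroup.mem_center_iff, MonoidHom.coe_coe]
  rw [e.forall_congr_left]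
  simp [← map_mul]

variable {K : Type u} [Field K] {F : Type v} [Field F]

/-- The isomorphism of projective special linear groups induced by an isomorphism of fields. -/
def projCongr (e : K ≃+* F) :
    ProjectiveSpecialLinearGroup (Fin 2) K ≃* ProjectiveSpecialLinearGroup (Fin 2) F :=
  let f : SpecialLinearGroup (Fin 2) K ≃* SpecialLinearGroup (Fin 2) F :=
    MonoidHom.toMulEquiv (SpecialLinearGroup.map e.toRingHom)
      (SpecialLinearGroup.map e.symm.toRingHom) (by ext; simp) (by ext; simp)
  QuotientGroup.congr _ _ f (map_center_mulEquiv f)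

variable [Finite F] [IsSimpleGroup (ProjectiveSpecialLinearGroup (Fin 2) F)]

theorem not_flagReflections_of_card_seven (hF : Nat.card F = 7) :
    ¬ GeneratedByFlagReflections (ProjectiveSpecialLinearGroup (Fin 2) F) := by
  intro h
  have := Fintype.ofFinite F
  have e := projCongr (K := ZMod 7) (ZMod.ringEquivOfPrime F (by norm_num)
    (Nat.card_eq_fintype_card.symm.trans hF))
  have := e.isSimpleGroup
  exact not_flagReflections_zmod_seven (h.of_mulEquiv e.symm)

theorem not_flagReflections_of_card_nine (hF : Nat.card F = 9) :
    ¬ GeneratedByFlagReflections (ProjectiveSpecialLinearGroup (Fin 2) F) := by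
  intro h
  have := Fintype.ofFinite F
  have e := projCongr (FiniteField.ringEquivOfCardEq (K := F9) (K' := F)
    (card_F9.trans (hF.symm.trans Nat.card_eq_fintype_card)))
  have := e.isSimpleGroup
  exact not_flagReflections_F9 (h.of_mulEquiv e.symm)

end Transport

section Classification

variable {F : Type u} [Field F] [Finite F]

theorem flagReflections_of_card_two (hF : Nat.card F = 2) :
    GeneratedByFlagReflections (ProjectiveSpecialLinearGroup (Fin 2) F) := by
  have h2 : (2 : F) = 0 := mod_cast card_cast_eq_zero hF
  refine flagReflections_of_entries (a := 1) (b := 1) (c := 0) (a' := 0) (b' := 1) (c' := 1)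
    (a'' := 1) (b'' := 1) (c'' := 0) (by linear_combination -h2) (by linear_combination -h2)
    (by linear_combination -h2) ?_ (by linear_combination h2)
  intro H hA hB _
  exact eq_top_of_prime_card (by rw [hF]; norm_num) (t := 1)
    (hA.congr rfl rfl rfl (by linear_combination -h2)) one_ne_zero hB one_ne_zero

omit [Finite F] in
theorem mul_mk_mul_inv (X : SpecialLinearGroup (Fin 2) F) :
    (X * mk 0 1 (-1) 0 (by ring) * X⁻¹).1 =
      !![-(X 0 0 * X 1 0 + X 0 1 * X 1 1), X 0 0 ^ 2 + X 0 1 ^ 2;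
        -(X 1 0 ^ 2 + X 1 1 ^ 2), X 0 0 * X 1 0 + X 0 1 * X 1 1] := by
  rw [Matrix.SpecialLinearGroup.coe_mul, Matrix.SpecialLinearGroup.coe_mul,
    Matrix.SpecialLinearGroup.coe_inv, adjugate_fin_two]
  ext i j
  fin_cases i <;> fin_cases j <;> simp [mk, Matrix.mul_apply] <;> ring

theorem commute_conj_of_card_eq_three (hF : Nat.card F = 3) (X : SpecialLinearGroup (Fin 2) F) :
    Commute (proj F (X * mk 0 1 (-1) 0 (by ring) * X⁻¹)) (proj F (mk 0 1 (-1) 0 (by ring))) := by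
  have := Fintype.ofFinite F
  have h3 : (3 : F) = 0 := mod_cast card_cast_eq_zero hF
  have sq_eq_one {x : F} (hx : x ≠ 0) : x ^ 2 = 1 := by
    have hpow := FiniteField.pow_card_sub_one_eq_one x hx
    rwa [← Nat.card_eq_fintype_card, hF] at hpow
  obtain ⟨M, hM⟩ : ∃ M, M = X * mk 0 1 (-1) 0 (by ring) * X⁻¹ := ⟨_, rfl⟩
  obtain ⟨p, q, r, hMpqr⟩ : ∃ p q r, M.1 = !![-q, p; -r, q] :=
    ⟨_, _, _, hM ▸ mul_mk_mul_inv X⟩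
  have hdet : p * r - q ^ 2 = 1 := by
    have hdet := M.2
    rw [hMpqr, det_fin_two_of] at hdet
    linear_combination hdet
  rw [← hM]
  by_cases hq : q = 0
  · have hp : p ≠ 0 := by
      rintro rfl
      simp [hq] at hdet
    have hr : r = p := mul_left_cancel₀ hp (by
      linear_combination hdet - sq_eq_one hp + q * hq)
    refine Commute.map (show M * mk 0 1 (-1) 0 (by ring) = mk 0 1 (-1) 0 (by ring) * M from
      Subtype.ext ?_) (proj F)
    rw [Matrix.SpecialLinearGroup.coe_mul, Matrix.SpecialLinearGroup.coe_mul, hMpqr]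
    simp [hq, hr, mk]
  · have hpr : p * r = -1 := by linear_combination hdet + sq_eq_one hq + h3
    have hp : p ≠ 0 := by
      rintro rfl
      simp at hpr
    have hr : r = -p := mul_left_cancel₀ hp (by linear_combination hpr + sq_eq_one hp)
    refine proj_comm ?_ ?_ ?_
    · rw [hMpqr, trace_fin_two_of, neg_add_cancel]
    · rw [trace_mk, add_zero]
    · rw [Matrix.SpecialLinearGroup.coe_mul, hMpqr]
      simp [mk, hr, trace_fin_two]

theorem card_ne_three [IsSimpleGroup (ProjectiveSpecialLinearGroup (Fin 2) F)] :
    Nat.card F ≠ 3 := by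
  intro hF
  have ne_one : proj F (mk 0 1 (-1) 0 (by ring)) ≠ 1 :=
    fun h => one_ne_zero (proj_eq_one_iff.mp h).1
  obtain ⟨g, hg⟩ := exists_not_commute_conj not_isMulCommutative_psl ne_one
  obtain ⟨X, rfl⟩ := proj_surjective g
  refine hg ?_
  rw [← map_inv, ← map_mul, ← map_mul]
  exact commute_conj_of_card_eq_three hF X

variable (F)

instance : Finite (ProjectiveSpecialLinearGroup (Fin 2) F) :=
  inferInstanceAs (Finite (_ ⧸ _))

theorem card_cases [IsSimpleGroup (ProjectiveSpecialLinearGroup (Fin 2) F)] :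
    Nat.card F ∈ ({2, 4, 5, 7, 9, 11, 13} : Finset ℕ) ∨ 15 < Nat.card F ∨
      ringChar F = 2 ∧ Nat.card F = 8 := by
  have := Fintype.ofFinite F
  have hq : IsPrimePow (Nat.card F) := by
    rw [Nat.card_eq_fintype_card]
    exact FiniteField.isPrimePow_card F
  have h3 := card_ne_three (F := F)
  by_cases h8 : Nat.card F = 8
  · refine Or.inr (Or.inr ⟨?_, h8⟩)
    have h2 : (2 : F) = 0 := by
      have h8' : ((8 : ℕ) : F) = 0 := card_cast_eq_zero h8
      exact pow_eq_zero_iff three_ne_zero |>.mp (by push_cast at h8'; linear_combination h8')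
    exact CharP.ringChar_of_prime_eq_zero Nat.prime_two (mod_cast h2)
  generalize Nat.card F = q at *
  refine (le_or_gt q 15).imp (fun hle => ?_) Or.inl
  rw [isPrimePow_nat_iff_bounded] at hq
  revert hq h3 h8
  interval_cases q <;> decide

theorem generatedByFlagReflections_iff
    [IsSimpleGroup (ProjectiveSpecialLinearGroup (Fin 2) F)] :
    GeneratedByFlagReflections (ProjectiveSpecialLinearGroup (Fin 2) F) ↔
      Nat.card F ≠ 7 ∧ Nat.card F ≠ 9 := by
  refine ⟨fun h => ⟨fun h7 => not_flagReflections_of_card_seven h7 h,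
    fun h9 => not_flagReflections_of_card_nine h9 h⟩, fun ⟨h7, h9⟩ => ?_⟩
  rcases card_cases F with h | h
  · simp only [Finset.mem_insert, Finset.mem_singleton, h7, h9, false_or] at h
    rcases h with h | h | h | h | h
    · exact flagReflections_of_card_two h
    · exact flagReflections_of_card_four h
    · have h5 : (5 : F) = 0 := mod_cast card_cast_eq_zero h
      exact flagReflections_of_prime (i := 2) (by rw [h]; norm_num) (by linear_combination h5)
    · exact flagReflections_of_card_eleven h
    · have h13 : (13 : F) = 0 := mod_cast card_cast_eq_zero h
      exact flagReflections_of_prime (i := 5) (by rw [h]; norm_num) (by linear_combination 2 * h13)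
  · exact flagReflections_of_torus h

theorem generatedByAsymmetricInvolutions
    [IsSimpleGroup (ProjectiveSpecialLinearGroup (Fin 2) F)] :
    GeneratedByAsymmetricInvolutions (ProjectiveSpecialLinearGroup (Fin 2) F) := by
  by_cases h7 : Nat.card F = 7
  · exact asymmetric_of_card_seven h7
  by_cases h9 : Nat.card F = 9
  · exact asymmetric_of_card_nine h9
  exact ((generatedByFlagReflections_iff F).mpr ⟨h7, h9⟩).asymmetric not_isMulCommutative_psl

end Classification

end SL2

theorem theorem6p1 (F : Type u) [Field F] [Finite F]
    [IsSimpleGroup (Matrix.ProjectiveSpecialLinearGroup (Fin 2) F)] :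
    (∀ T : EdgeTransitiveClass,
      T.Realises (Matrix.ProjectiveSpecialLinearGroup (Fin 2) F) ↔
        ((T = .one ∧ Nat.card F ≠ 7 ∧ Nat.card F ≠ 9) ∨
          (∃ σ, T = .two σ) ∨ T = .three ∨ (∃ σ, T = .four σ))) ∧
    ∀ σ : ClassSuperscript,
      ¬ (EdgeTransitiveClass.twoEx σ).Realises (Matrix.ProjectiveSpecialLinearGroup (Fin 2) F) ∧
      ¬ (EdgeTransitiveClass.five σ).Realises (Matrix.ProjectiveSpecialLinearGroup (Fin 2) F) := by
  have hiff (T : EdgeTransitiveClass) :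
      T.Realises (Matrix.ProjectiveSpecialLinearGroup (Fin 2) F) ↔ _ :=
    EdgeTransitiveClass.realises_iff_of_generation (SL2.generatedByAsymmetricInvolutions F)
      (SL2.generatingPairsInvertible F) T
  simp only [SL2.generatedByFlagReflections_iff F] at hiff
  exact ⟨hiff, fun σ => ⟨by simp [hiff], by simp [hiff]⟩⟩
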